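/- Fix a signature: $\eta=\mathrm{diag}(1,1,1)$ (Euclidean) or $\eta=\mathrm{diag}(1,-1,-1)$ (Lorentzian); indices $a,b,c\in\{0,1,2\}$ are raised and lowered with $\eta$, repeated indices are summed, $\mathbf x\cdot\mathbf y=\eta_{ab}x^ay^b$, and $\epsilon$ is totally antisymmetric with $\epsilon_{012}=\epsilon^{012}=1$. Let $\Lambda\in\mathbb R$ and let $\mathbf n\in\mathbb R^3$ satisfy $\mathbf n\cdot\mathbf n=-\Lambda$ (so $\Lambda\le 0$ in the Euclidean case). Let $R_\Lambda=\mathbb R\oplus\theta\mathbb R$ with $\theta^2=\Lambda$, $\mathrm{Re}_\theta(a+\theta b)=a$, $\mathrm{Im}_\theta(a+\theta b)=b$, $(a+\theta b)^*=a-\theta b$. Let $\mathbb H(R_\Lambda)$ be the algebra of (split) quaternions $g=g_3+g^ae_a$, $g_3,g^a\in R_\Lambda$, with $e_ae_b=-\eta_{ab}+\epsilon_{abc}e^c$; put $\bar g=g_3-g^ae_a$, $\Pi(g)=g_3$, $g^*=g_3^*+(g^a)^*e_a$, $g^\circ=(\bar g)^*$. Let $\mathbb H_1(R_\Lambda)=\{g: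 g\bar g=1\}$, $\mathbb H_1=\{u\in\mathbb H_1(R_\Lambda): u^*=u\}$, $J_a=\tfrac12e_a$, $S_a=\tfrac\theta2e_a+\tfrac12\epsilon_{abc}n^be^c$, and let $AN(2)_{\mathbf n}\subset\mathbb H_1(R_\Lambda)$ be the subgroup generated by the elements $\exp(q^aS_a)$, $q\in\mathbb R^3$ (it is $\cong\mathbb R^3$ if $\mathbf n=0$). Let $$F(\mathbf n)=\{g\in\mathbb H_1(R_\Lambda):\ \Pi(g^\circ g(1-\tfrac{n^ae_a}{\theta}))>0\},$$ where for $w=g^\circ g$ the expression $\Pi(w(1-n^ae_a/\theta))$ means $\mathrm{Re}_\theta\Pi(w)-\mathrm{Im}_\theta\Pi(w\,n^ae_a)$ (for $\Lambda\neq0$ this is the literal value with $1/\theta=\theta/\Lambda$). For functions $f$ on $\mathbb H_1(R_\Lambda)$ and a Lie algebra element $X$ put $X^Lf(g)=\frac{d}{dt}|_{t=0}f(e^{-tX}g)$ and $X^Rf(g)=\frac{d}{dt}|_{t=0}f(ge^{tX})$. With $X\wedge Y=X\otimes Y-Y\otimes X$, the Sklyanin bracket $\{\,,\}_S$ and the dual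 (Semenov-Tian-Shansky) bracket $\{\,,\}_D$ of the $r$-matrix $r=S_a\otimes J^a$ are given by the bivectors $$B_S=\tfrac12\left(S_a^R\wedge J^{aR}-S_a^L\wedge J^{aL}\right),\qquad B_D=\tfrac12\left(S_a^R\wedge J^{aR}+S_a^L\wedge J^{aL}\right)+S_a^R\wedge J^{aL}.$$ **Theorem.** Every $g\in F(\mathbf n)$ factorises uniquely as $g=u\cdot s$ with $u=u(g)\in\mathbb H_1$, $s=s(g)\in AN(2)_{\mathbf n}$. The functions $p^a(g)=-2\Pi(u(g)e^a)$, $q^a(g)=-2\,\mathrm{Im}_\theta\Pi(s(g)e^a)$, $p_3(g)=\Pi(u(g))$ and $q_3=\sqrt{1+(\mathbf q\cdot\mathbf n)^2/4}$ are smooth on $F(\mathbf n)$, $p_3=\pm\sqrt{1-\mathbf p^2/4}$, and on $F(\mathbf n)$ $$\{p^a,p^b\}_S=-p_3(n^ap^b-p^an^b),\quad \{q^a,q^b\}_S=q_3\epsilon^{abc}q_c,\quad \{p^a,q^b\}_S=0,$$ $$\{p^a,p^b\}_D=p_3(n^ap^b-p^an^b),\quad \{q^a,q^b\}_D=q_3\epsilon^{abc}q_c,\quad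 \{p^a,q^b\}_D=q_3\epsilon^{abc}p_c+p_3\left((\mathbf q\cdot\mathbf n)\eta^{ab}-n^aq^b\right).$$ Moreover $$\mathrm{Im}_\theta\Pi(us)=-\tfrac14p_aq^a,\qquad \mathrm{Re}_\theta\Pi(us)=p_3q_3-\tfrac14\epsilon_{abc}n^ap^bq^c,$$ and both are Casimir functions of the dual bracket on $F(\mathbf n)$: they are smooth and $\{C,f\}_D=0$ for every smooth function $f$ on $F(\mathbf n)$. -/

import Mathlib

open scoped ContDiff

noncomputable section

namespace Gravity3d

/-- Euclidean or Lorentzian signature. -/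
inductive Signature
  | E
  | L

/-- The common value of `η₁₁` and `η₂₂`: `1` for `diag(1,1,1)`, `-1` for `diag(1,-1,-1)`. -/
def Signature.sgn : Signature → ℝ
  | .E => 1
  | .L => -1

/-- The metric `η = diag(1,1,1)` or `η = diag(1,-1,-1)`; it is its own inverse, so the same matrix
serves for `η_{ab}` and `η^{ab}`. -/
def eta (σ : Signature) : Matrix (Fin 3) (Fin 3) ℝ := Matrix.diagonal ![1, σ.sgn, σ.sgn]

/-- The totally antisymmetric symbol with `ε₀₁₂ = ε⁰¹² = 1` (in both signatures). -/
def eps (a b c : Fin 3) : ℝ :=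
  ((b.val : ℝ) - a.val) * ((c.val : ℝ) - a.val) * ((c.val : ℝ) - b.val) / 2

/-- The inner product `x · y = η_{ab} x^a y^b`. -/
def dot (σ : Signature) (x y : Fin 3 → ℝ) : ℝ := ∑ a, ∑ b, eta σ a b * x a * y b

/-- Lowering an index: `x_a = η_{ab} x^b`. -/
def lower (σ : Signature) (x : Fin 3 → ℝ) (a : Fin 3) : ℝ := ∑ b, eta σ a b * x b

/-- The ring `R_Λ = ℝ ⊕ θℝ` with `θ² = Λ`; `Re_θ` and `Im_θ` are the projections `re`, `im`. -/
abbrev R (Λ : ℝ) : Type := QuadraticAlgebra ℝ Λ 0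

/-- The formal parameter `θ`. -/
def theta (Λ : ℝ) : R Λ := ⟨0, 1⟩

/-- The algebra `ℍ^{E,L}(R_Λ)` of (split) quaternions over `R_Λ`. It has the `R_Λ`-basis
`1, i, j, k = ij` with `i² = -1`, `j² = -η₁₁`; see `e` and `e_mul_e` for the generators `e_a`. The
quaternionic conjugation, extended `R_Λ`-linearly, is `star`. -/
abbrev H (σ : Signature) (Λ : ℝ) : Type :=
  QuaternionAlgebra (R Λ) (-1) 0 (⟨-σ.sgn, 0⟩)

variable {σ : Signature} {Λ : ℝ}

/-- The generators `e_0, e_1, e_2`. -/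
def e : Fin 3 → H σ Λ := ![⟨0, 1, 0, 0⟩, ⟨0, 0, 1, 0⟩, ⟨0, 0, 0, ⟨σ.sgn, 0⟩⟩]

/-- The generators with raised index, `e^a = η^{ab} e_b`. -/
def eUp (a : Fin 3) : H σ Λ := ∑ b, eta σ a b • e b

open scoped QuadraticAlgebra in
/-- The defining relations `e_a e_b = -η_{ab} 1 + ε_{abc} e^c`. -/
theorem e_mul_e (a b : Fin 3) :
    (e a * e b : H σ Λ) = (-eta σ a b) • 1 + ∑ c, eps a b c • eUp c := by
  have hs : σ.sgn * σ.sgn = 1 := by cases σ <;> simp [Signature.sgn]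
  fin_cases a <;> fin_cases b <;>
    simp [e, eUp, eta, eps, Fin.sum_univ_three, Matrix.diagonal] <;>
    ext <;>
    simp <;>
    first
    | linear_combination hs
    | linear_combination -hs
    | linear_combination 2 * hs
    | linear_combination -2 * hs
    | linear_combination σ.sgn * hs
    | linear_combination -σ.sgn * hs
    | ring

/-- The conjugation `(a + θ b)^* = a - θ b` of `R_Λ`. -/
def conjR (z : R Λ) : R Λ := ⟨z.re, -z.im⟩

/-- The conjugation `*` of `R_Λ`, extended to `ℍ(R_Λ)` coefficientwise. -/
def conjTheta (g : H σ Λ) : H σ Λ :=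
  ⟨conjR g.re, conjR g.imI, conjR g.imJ, conjR g.imK⟩

/-- The involution `g° = (ḡ)^*`. -/
def circ (g : H σ Λ) : H σ Λ := conjTheta (star g)

/-- The projection `Π` onto the coefficient of the unit quaternion `1`. -/
def proj (g : H σ Λ) : R Λ := g.re

/-! ### Topology of `ℍ(R_Λ) ≅ ℝ⁸`

A submultiplicative norm (a weighted sum of the absolute values of the eight real coordinates);
it gives the usual topology and smooth structure of the eight-dimensional space. -/

/-- An auxiliary norm on `R_Λ`. -/
def normR (z : R Λ) : ℝ := |z.re| + (1 + |Λ|) * |z.im|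

theorem normR_nonneg (z : R Λ) : 0 ≤ normR z := by unfold normR; positivity

theorem normR_add (z w : R Λ) : normR (z + w) ≤ normR z + normR w := by
  unfold normR
  have h1 := abs_add_le z.re w.re
  have h2 := mul_le_mul_of_nonneg_left (abs_add_le z.im w.im)
    (by positivity : 0 ≤ 1 + |Λ|)
  simp only [QuadraticAlgebra.re_add, QuadraticAlgebra.im_add]
  linarith

theorem normR_neg (z : R Λ) : normR (-z) = normR z := by simp [normR]

theorem normR_sub (z w : R Λ) : normR (z - w) ≤ normR z + normR w := by
  rw [sub_eq_add_neg, ← normR_neg w]; exact normR_add _ _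

theorem normR_eq_zero {z : R Λ} (h : normR z = 0) : z = 0 := by
  unfold normR at h
  have h1 := abs_nonneg z.re
  have h2 := abs_nonneg z.im
  have h3 := abs_nonneg Λ
  have h4 : |z.im| ≤ (1 + |Λ|) * |z.im| := by nlinarith
  ext
  · exact abs_eq_zero.1 (by linarith)
  · exact abs_eq_zero.1 (by linarith)

theorem normR_mul (z w : R Λ) : normR (z * w) ≤ normR z * normR w := by
  unfold normR
  simp only [QuadraticAlgebra.re_mul, QuadraticAlgebra.im_mul, zero_mul, add_zero]
  have h1 : |z.re * w.re + Λ * z.im * w.im| ≤ |z.re| * |w.re| + |Λ| * |z.im| * |w.im| := by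
    refine (abs_add_le _ _).trans ?_
    simp [abs_mul]
  have h2 : |z.re * w.im + z.im * w.re| ≤ |z.re| * |w.im| + |z.im| * |w.re| := by
    refine (abs_add_le _ _).trans ?_
    simp [abs_mul]
  have h3 := mul_le_mul_of_nonneg_left h2 (by positivity : 0 ≤ 1 + |Λ|)
  have h4 : 0 ≤ (1 + |Λ| + |Λ| ^ 2) * (|z.im| * |w.im|) := by positivity
  nlinarith

/-- An auxiliary norm on `ℍ(R_Λ)`. -/
def normH (g : H σ Λ) : ℝ := normR g.re + normR g.imI + normR g.imJ + normR g.imK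

theorem normH_mul (g h : H σ Λ) : normH (g * h) ≤ normH g * normH h := by
  have hc : ∀ z : R Λ, normR ((⟨-σ.sgn, 0⟩ : R Λ) * z) = normR z := by
    intro z
    cases σ <;> simp [Signature.sgn, normR]
  have key : ∀ a b c d : R Λ, ∀ x y z w : ℝ, normR a ≤ x → normR b ≤ y → normR c ≤ z →
      normR d ≤ w → normR (a + b + c + d) ≤ x + y + z + w := by
    intro a b c d x y z w h1 h2 h3 h4
    have := normR_add (a + b + c) d
    have := normR_add (a + b) c
    have := normR_add a b
    linarith
  have hm : ∀ a b : R Λ, normR (-(a * b)) ≤ normR a * normR b := fun a b ↦ by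
    rw [normR_neg]; exact normR_mul a b
  have hmc : ∀ a b : R Λ,
      normR ((⟨-σ.sgn, 0⟩ : R Λ) * (a * b)) ≤ normR a * normR b := fun a b ↦ by
    rw [hc]; exact normR_mul a b
  have hmc' : ∀ a b : R Λ,
      normR (-((⟨-σ.sgn, 0⟩ : R Λ) * (a * b))) ≤ normR a * normR b := fun a b ↦ by
    rw [normR_neg, hc]; exact normR_mul a b
  have h0 : (g * h).re = g.re * h.re + -(g.imI * h.imI)
      + (⟨-σ.sgn, 0⟩ : R Λ) * (g.imJ * h.imJ)
      + (⟨-σ.sgn, 0⟩ : R Λ) * (g.imK * h.imK) := by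
    rw [QuaternionAlgebra.re_mul]; ring
  have h1 : (g * h).imI = g.re * h.imI + g.imI * h.re
      + -((⟨-σ.sgn, 0⟩ : R Λ) * (g.imJ * h.imK))
      + (⟨-σ.sgn, 0⟩ : R Λ) * (g.imK * h.imJ) := by
    rw [QuaternionAlgebra.imI_mul]; ring
  have h2 : (g * h).imJ = g.re * h.imJ + -(g.imI * h.imK) + g.imJ * h.re
      + g.imK * h.imI := by
    rw [QuaternionAlgebra.imJ_mul]; ring
  have h3 : (g * h).imK = g.re * h.imK + g.imI * h.imJ + -(g.imJ * h.imI)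
      + g.imK * h.re := by
    rw [QuaternionAlgebra.imK_mul]; ring
  unfold normH
  rw [h0, h1, h2, h3]
  have k0 := key _ _ _ _ _ _ _ _ (normR_mul g.re h.re) (hm g.imI h.imI) (hmc g.imJ h.imJ)
    (hmc g.imK h.imK)
  have k1 := key _ _ _ _ _ _ _ _ (normR_mul g.re h.imI) (normR_mul g.imI h.re)
    (hmc' g.imJ h.imK) (hmc g.imK h.imJ)
  have k2 := key _ _ _ _ _ _ _ _ (normR_mul g.re h.imJ) (hm g.imI h.imK)
    (normR_mul g.imJ h.re) (normR_mul g.imK h.imI)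
  have k3 := key _ _ _ _ _ _ _ _ (normR_mul g.re h.imK) (normR_mul g.imI h.imJ)
    (hm g.imJ h.imI) (normR_mul g.imK h.re)
  refine (add_le_add (add_le_add (add_le_add k0 k1) k2) k3).trans (le_of_eq ?_)
  ring

instance instNormedAddCommGroupH : NormedAddCommGroup (H σ Λ) :=
  AddGroupNorm.toNormedAddCommGroup
    { toFun := normH
      map_zero' := by simp [normH, normR]
      add_le' := fun x y ↦ by
        have h0 := normR_add x.re y.re
        have h1 := normR_add x.imI y.imI
        have h2 := normR_add x.imJ y.imJ
        have h3 := normR_add x.imK y.imK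
        simp only [normH, QuaternionAlgebra.re_add, QuaternionAlgebra.imI_add,
          QuaternionAlgebra.imJ_add, QuaternionAlgebra.imK_add]
        linarith
      neg' := fun x ↦ by
        simp [normH, normR_neg]
      eq_zero_of_map_eq_zero' := fun x hx ↦ by
        have hx : normR x.re + normR x.imI + normR x.imJ + normR x.imK = 0 := hx
        have h0 := normR_nonneg x.re
        have h1 := normR_nonneg x.imI
        have h2 := normR_nonneg x.imJ
        have h3 := normR_nonneg x.imK
        ext1
        · exact normR_eq_zero (by linarith)
        · exact normR_eq_zero (by linarith)
        · exact normR_eq_zero (by linarith)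
        · exact normR_eq_zero (by linarith) }

instance instNormedRingH : NormedRing (H σ Λ) where
  __ := (inferInstance : Ring (H σ Λ))
  __ := instNormedAddCommGroupH
  norm_mul_le := normH_mul

instance instNormedAlgebraH : NormedAlgebra ℝ (H σ Λ) where
  norm_smul_le r x := by
    change normH (r • x) ≤ |r| * normH x
    refine le_of_eq ?_
    simp only [normH, normR, QuaternionAlgebra.re_smul, QuaternionAlgebra.imI_smul,
      QuaternionAlgebra.imJ_smul, QuaternionAlgebra.imK_smul, QuadraticAlgebra.re_smul,
      QuadraticAlgebra.im_smul, smul_eq_mul, abs_mul]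
    ring

/-! ### The groups -/

/-- The group `ℍ₁(R_Λ)` of unit (split) quaternions over `R_Λ`, `g ḡ = 1`. -/
def unitGroup (σ : Signature) (Λ : ℝ) : Set (H σ Λ) := {g | g * star g = 1}

/-- The group `ℍ₁` of real unit (split) quaternions: `u ∈ ℍ₁(R_Λ)` with `u^* = u`. -/
def realUnitGroup (σ : Signature) (Λ : ℝ) : Set (H σ Λ) :=
  {u | u ∈ unitGroup σ Λ ∧ conjTheta u = u}

/-- The generators `J_a = e_a / 2`. -/
def J (a : Fin 3) : H σ Λ := (1 / 2 : ℝ) • e a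

/-- The generators with raised index, `J^a = η^{ab} J_b`. -/
def JUp (a : Fin 3) : H σ Λ := ∑ b, eta σ a b • J b

/-- The generators `S_a = θ e_a / 2 + ε_{abc} n^b e^c / 2`. -/
def S (n : Fin 3 → ℝ) (a : Fin 3) : H σ Λ :=
  (1 / 2 : ℝ) • (theta Λ • e a) + (1 / 2 : ℝ) • ∑ b, ∑ c, (eps a b c * n b) • eUp c

/-- `AN(2)_n` (which is `ℝ³` for `n = 0`): the connected subgroup with Lie algebra
`span {S_0, S_1, S_2}`, i.e. the one generated by the exponentials `exp (q^a S_a)`. As the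
inverses of these exponentials are among them, the generated submonoid is that subgroup. -/
def AN2 (σ : Signature) (Λ : ℝ) (n : Fin 3 → ℝ) : Submonoid (H σ Λ) :=
  Submonoid.closure (Set.range fun q : Fin 3 → ℝ ↦ NormedSpace.exp (∑ a, q a • S n a))

/-- The number `Π (w (1 - n^a e_a / θ))` for `w = w°`. Since then `Π (w n^a e_a) ∈ θ ℝ`,
the quotient by `θ` (also for `Λ = 0`) is the `θ`-component. -/
def projQuot (n : Fin 3 → ℝ) (w : H σ Λ) : ℝ :=
  (proj w).re - (proj (w * ∑ a, n a • e a)).im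

open scoped QuadraticAlgebra in
/-- For `Λ ≠ 0`, where `1/θ = θ/Λ`, `projQuot` is literally `Π (g° g (1 - n^a e_a / θ))`. -/
theorem projQuot_eq (hΛ : Λ ≠ 0) (n : Fin 3 → ℝ) (g : H σ Λ) :
    proj (circ g * g * (1 - (Λ⁻¹ • theta Λ) • ∑ a, n a • e a)) =
      algebraMap ℝ (R Λ) (projQuot n (circ g * g)) := by
  ext <;>
  · simp [proj, projQuot, circ, conjTheta, conjR, e, theta, Fin.sum_univ_three]
    field_simp
    ring

/-- The set `F(n) = {g ∈ ℍ₁(R_Λ) | Π (g° g (1 - n^a e_a / θ)) > 0}` of factorisable elements. -/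
def F (σ : Signature) (Λ : ℝ) (n : Fin 3 → ℝ) : Set (H σ Λ) :=
  {g | g ∈ unitGroup σ Λ ∧ 0 < projQuot n (circ g * g)}

/-- `g = u s` with `u ∈ ℍ₁` and `s ∈ AN(2)_n`. -/
def IsFactorisation (n : Fin 3 → ℝ) (g : H σ Λ) (us : H σ Λ × H σ Λ) : Prop :=
  us.1 ∈ realUnitGroup σ Λ ∧ us.2 ∈ AN2 σ Λ n ∧ g = us.1 * us.2

open Classical in
/-- The pair `(u(g), s(g))` of the factorisation `g = u(g) s(g)` (a dummy value if there is
none). -/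
def factors (n : Fin 3 → ℝ) (g : H σ Λ) : H σ Λ × H σ Λ :=
  if h : ∃ us, IsFactorisation n g us then h.choose else (1, 1)

/-- The factor `u(g) ∈ ℍ₁`. -/
def u (n : Fin 3 → ℝ) (g : H σ Λ) : H σ Λ := (factors n g).1

/-- The factor `s(g) ∈ AN(2)_n`. -/
def s (n : Fin 3 → ℝ) (g : H σ Λ) : H σ Λ := (factors n g).2

/-! ### Coordinate functions -/

/-- `p^a(g) = -2 Π (u(g) e^a)` (a real number, as `u(g)` is real). -/
def p (n : Fin 3 → ℝ) (a : Fin 3) (g : H σ Λ) : ℝ := -2 * (proj (u n g * eUp a)).re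

/-- `q^a(g) = -2 Im_θ Π (s(g) e^a)`. -/
def q (n : Fin 3 → ℝ) (a : Fin 3) (g : H σ Λ) : ℝ := -2 * (proj (s n g * eUp a)).im

/-- `p_3(g) = Π (u(g))`. -/
def p3 (n : Fin 3 → ℝ) (g : H σ Λ) : ℝ := (proj (u n g)).re

/-- The scalar `q · n`. -/
def qn (n : Fin 3 → ℝ) (g : H σ Λ) : ℝ := dot σ (fun a ↦ q n a g) n

/-- `q_3 = √(1 + (q · n)² / 4)`. -/
def q3 (n : Fin 3 → ℝ) (g : H σ Λ) : ℝ := √(1 + qn n g ^ 2 / 4)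

/-! ### Poisson brackets of a classical `r`-matrix

An `r`-matrix `r = ∑ᵢ Aᵢ ⊗ Bᵢ` is given by the two families `A`, `B`; `X ∧ Y = X ⊗ Y - Y ⊗ X`. -/

/-- `X^L f (g) = d/dt f (exp (-t X) g)` at `t = 0`. -/
def vecL (X : H σ Λ) (f : H σ Λ → ℝ) (g : H σ Λ) : ℝ :=
  deriv (fun t : ℝ ↦ f (NormedSpace.exp (-(t • X)) * g)) 0

/-- `X^R f (g) = d/dt f (g exp (t X))` at `t = 0`. -/
def vecR (X : H σ Λ) (f : H σ Λ → ℝ) (g : H σ Λ) : ℝ :=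
  deriv (fun t : ℝ ↦ f (g * NormedSpace.exp (t • X))) 0

/-- `(V ∧ W)(f, h)` for vector fields `V`, `W`. -/
def wedge (V W : (H σ Λ → ℝ) → H σ Λ → ℝ) (f h : H σ Λ → ℝ) (g : H σ Λ) : ℝ :=
  V f g * W h g - V h g * W f g

/-- The Sklyanin bracket, with bivector `½ ∑ᵢ (Aᵢ^R ∧ Bᵢ^R - Aᵢ^L ∧ Bᵢ^L)`. -/
def sklyaninBracket {ι : Type} [Fintype ι] (A B : ι → H σ Λ) (f h : H σ Λ → ℝ) (g : H σ Λ) : ℝ :=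
  1 / 2 * ∑ i, (wedge (vecR (A i)) (vecR (B i)) f h g - wedge (vecL (A i)) (vecL (B i)) f h g)

/-- The dual (Semenov-Tian-Shansky) bracket, with bivector
`½ ∑ᵢ (Aᵢ^R ∧ Bᵢ^R + Aᵢ^L ∧ Bᵢ^L) + ∑ᵢ Aᵢ^R ∧ Bᵢ^L`. -/
def dualBracket {ι : Type} [Fintype ι] (A B : ι → H σ Λ) (f h : H σ Λ → ℝ) (g : H σ Λ) : ℝ :=
  1 / 2 * ∑ i, (wedge (vecR (A i)) (vecR (B i)) f h g + wedge (vecL (A i)) (vecL (B i)) f h g)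
    + ∑ i, wedge (vecR (A i)) (vecL (B i)) f h g

/-- The Sklyanin bracket `{f, h}_S` of the `r`-matrix `r = S_a ⊗ J^a`. -/
def bracketS (n : Fin 3 → ℝ) (f h : H σ Λ → ℝ) (g : H σ Λ) : ℝ :=
  sklyaninBracket (S n) JUp f h g

/-- The dual bracket `{f, h}_D` of the `r`-matrix `r = S_a ⊗ J^a`. -/
def bracketD (n : Fin 3 → ℝ) (f h : H σ Λ → ℝ) (g : H σ Λ) : ℝ :=
  dualBracket (S n) JUp f h g

/-- `f` restricts to a smooth function on `F(n)`, an open subset of the submanifold `ℍ₁(R_Λ)`. -/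
def SmoothOnF (n : Fin 3 → ℝ) (f : H σ Λ → ℝ) : Prop := ContDiffOn ℝ ∞ f (F σ Λ n)

/-- `C` is a Casimir function of the dual bracket on `F(n)`: it is smooth and has vanishing
bracket with every smooth function on `F(n)`. -/
def IsCasimirD (n : Fin 3 → ℝ) (C : H σ Λ → ℝ) : Prop :=
  SmoothOnF n C ∧ ∀ f : H σ Λ → ℝ, SmoothOnF n f → ∀ g ∈ F σ Λ n, bracketD n C f g = 0

end Gravity3d

end

noncomputable section

namespace Gravity3d

open scoped QuadraticAlgebra

variable {σ : Signature} {Λ : ℝ}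

/-! The factorisation rests on one element. Since `n · n = -Λ`, the quaternion `n^a e_a` squares to
`Λ = θ²`, so `θ - n^a e_a` is a zero divisor. For `g = A + θ B` with `A`, `B` real, `g (θ - n^a e_a)
= (A - B n^a e_a)(θ - n^a e_a)`; the real quaternion `core n g = A - B n^a e_a` therefore records
how `g` acts on this element (`mul_thetaSub`). The generators `S_a` act on it by real scalars
(`core_sVec`), and `AN(2)_n` turns out to be exactly the unit quaternions whose core is a positive
real number (`core_of_mem_AN2`, `eq_anElt`, `anElt_mem_AN2`). Applying `core` to `g = u s` gives a
positive multiple of `u`, so `u` must be the normalised core and `s = ū g`. The square norm of the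
core is the expression defining `F(n)` (`projQuot_circ_mul`), which gives existence, uniqueness and
smooth formulas together.

For the brackets, a tangent vector at `g = u s` is written `u (Y s + t)` with `Y` real and pure and
`core n t` a real scalar; then `u` varies by `u Y` and `s` by `t` (`IsSplitting`). Such splittings
for the translations by `S_a` and `J^a` on both sides give all derivatives of `p` and `q`. Two
contractions, `sum_adj_mul_leftJp` (rotations are orthogonal) and `sum_mul_dress`, collapse the sums
over the `r`-matrix to polynomial identities.

For the Casimirs, `u s = g`, so both functions are restrictions of real linear functionals `l` with
`l (x y) = l (y x)`. Their dual bracket with `f` is half the differential of `f` on the commutator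
of `g` with an element built from the symmetrised `r`-matrix. That element is a multiple of `g - ḡ`
or of `θ (g - ḡ)`, which commutes with `g` (`isCasimirD_of_eqOn`, `sum_imCLM`, `sum_reCLM`). -/

instance : FiniteDimensional ℝ (H σ Λ) := Module.Finite.trans (R Λ) (H σ Λ)

instance : CompleteSpace (H σ Λ) := FiniteDimensional.complete ℝ (H σ Λ)

/-- Quaternionic conjugation as a continuous `ℝ`-linear map. -/
def starCLM : H σ Λ →L[ℝ] H σ Λ :=
  LinearMap.toContinuousLinearMap
    { toFun := star
      map_add' := star_add
      map_smul' := fun c x ↦ QuaternionAlgebra.star_smul' c x }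

@[simp] theorem starCLM_apply (g : H σ Λ) : starCLM g = star g := rfl

instance : ContinuousStar (H σ Λ) := ⟨starCLM.continuous⟩

/-! ### The zero divisor `θ - n^a e_a` and the core -/

/-- The coefficientwise `θ`-component of a quaternion over `R_Λ`. -/
def imTheta : H σ Λ →ₗ[ℝ] H σ Λ where
  toFun g := ⟨⟨g.re.im, 0⟩, ⟨g.imI.im, 0⟩, ⟨g.imJ.im, 0⟩, ⟨g.imK.im, 0⟩⟩
  map_add' x y := by ext <;> simp
  map_smul' c x := by ext <;> simp

/-- The quaternion `n^a e_a`. -/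
def vec (x : Fin 3 → ℝ) : H σ Λ := ∑ a, x a • e a

/-- The zero divisor `θ - n^a e_a` (for `n · n = -Λ`). -/
def thetaSub (n : Fin 3 → ℝ) : H σ Λ := theta Λ • 1 - vec n

/-- The real quaternion `A - B n^a e_a` attached to `g = A + θ B`, i.e. the `θ`-component of
`g (θ - n^a e_a)`. -/
def core (n : Fin 3 → ℝ) : H σ Λ →ₗ[ℝ] H σ Λ := imTheta ∘ₗ LinearMap.mulRight ℝ (thetaSub n)

theorem core_apply (n : Fin 3 → ℝ) (g : H σ Λ) : core n g = imTheta (g * thetaSub n) := rfl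

/-- The square norm of `core n g`; it is positive exactly on the factorisable elements. -/
def coreSq (n : Fin 3 → ℝ) (g : H σ Λ) : ℝ := (core n g * star (core n g)).re.re

theorem Signature.sgn_mul_self (σ : Signature) : σ.sgn * σ.sgn = 1 := by
  cases σ <;> simp [Signature.sgn]

theorem dot_eq (x y : Fin 3 → ℝ) :
    dot σ x y = x 0 * y 0 + σ.sgn * x 1 * y 1 + σ.sgn * x 2 * y 2 := by
  simp [dot, eta, Fin.sum_univ_three, Matrix.diagonal]

theorem vec_eq (x : Fin 3 → ℝ) :
    (vec x : H σ Λ) = ⟨0, ⟨x 0, 0⟩, ⟨x 1, 0⟩, ⟨σ.sgn * x 2, 0⟩⟩ := by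
  ext <;> simp [vec, e, Fin.sum_univ_three, mul_comm]

theorem eUp_eq (a : Fin 3) : (eUp a : H σ Λ) = vec (fun b ↦ eta σ a b) := rfl

theorem thetaSub_eq (n : Fin 3 → ℝ) :
    (thetaSub n : H σ Λ) = ⟨⟨0, 1⟩, ⟨-n 0, 0⟩, ⟨-n 1, 0⟩, ⟨-(σ.sgn * n 2), 0⟩⟩ := by
  ext <;> simp [thetaSub, vec_eq, theta]

theorem conjTheta_eq_iff {u : H σ Λ} :
    conjTheta u = u ↔ u.re.im = 0 ∧ u.imI.im = 0 ∧ u.imJ.im = 0 ∧ u.imK.im = 0 := by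
  have h : ∀ x : ℝ, -x = x ↔ x = 0 := fun x ↦ by constructor <;> intro h <;> linarith
  rw [QuaternionAlgebra.ext_iff]
  simp only [conjTheta, conjR, QuadraticAlgebra.ext_iff, h, true_and]

theorem exists_of_conjTheta_eq {u : H σ Λ} (hu : conjTheta u = u) :
    ∃ a b c d : ℝ, u = ⟨⟨a, 0⟩, ⟨b, 0⟩, ⟨c, 0⟩, ⟨d, 0⟩⟩ := by
  obtain ⟨h0, h1, h2, h3⟩ := conjTheta_eq_iff.1 hu
  exact ⟨u.re.re, u.imI.re, u.imJ.re, u.imK.re, by ext <;> simp [*]⟩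

theorem imTheta_mul_of_conjTheta_eq {u : H σ Λ} (hu : conjTheta u = u) (g : H σ Λ) :
    imTheta (u * g) = u * imTheta g := by
  obtain ⟨a, b, c, d, rfl⟩ := exists_of_conjTheta_eq hu
  ext <;> simp [imTheta]

theorem core_mul_of_conjTheta_eq {u : H σ Λ} (hu : conjTheta u = u) (n : Fin 3 → ℝ) (g : H σ Λ) :
    core n (u * g) = u * core n g := by
  rw [core_apply, core_apply, mul_assoc, imTheta_mul_of_conjTheta_eq hu]

theorem conjTheta_core (n : Fin 3 → ℝ) (g : H σ Λ) : conjTheta (core n g) = core n g := by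
  rw [conjTheta_eq_iff]
  simp [core_apply, imTheta]

theorem conjTheta_star {u : H σ Λ} (hu : conjTheta u = u) : conjTheta (star u) = star u := by
  obtain ⟨a, b, c, d, rfl⟩ := exists_of_conjTheta_eq hu
  simp [conjTheta, conjR]

theorem conjTheta_smul {u : H σ Λ} (hu : conjTheta u = u) (r : ℝ) :
    conjTheta (r • u) = r • u := by
  obtain ⟨a, b, c, d, rfl⟩ := exists_of_conjTheta_eq hu
  ext <;> simp [conjTheta, conjR]

theorem core_one (n : Fin 3 → ℝ) : core n (1 : H σ Λ) = 1 := by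
  ext <;> simp [core_apply, thetaSub_eq, imTheta]

/-- The `θ`-components agree by definition of the core. The real components agree because `n^a e_a`
squares to `Λ`. -/
theorem mul_thetaSub {n : Fin 3 → ℝ} (hn : dot σ n n = -Λ) (g : H σ Λ) :
    g * thetaSub n = core n g * thetaSub n := by
  have hΛ : Λ = -(n 0 * n 0 + σ.sgn * n 1 * n 1 + σ.sgn * n 2 * n 2) := by
    rw [dot_eq] at hn; linarith
  have hs := σ.sgn_mul_self
  ext <;> simp [core_apply, thetaSub_eq, imTheta] <;> grind

/-- The core is not multiplicative, but a real scalar core of the right factor passes through `g`.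
-/
theorem core_mul_of_core_eq_smul {n : Fin 3 → ℝ} (hn : dot σ n n = -Λ) {g h : H σ Λ} {m : ℝ}
    (hh : core n h = m • 1) : core n (g * h) = m • core n g := by
  rw [core_apply, mul_assoc, mul_thetaSub hn, hh, core_apply]
  simp

/-- With `g = A + θ B` and `n` for `n^a e_a`, the square norm of `A - B n` is `|A|² - Λ |B|²` plus
the cross terms of `A n B̄ - B n Ā`. By cyclicity of `Π` these are the terms of `-Π ((Ā B - B̄ A)
n)`. -/
theorem projQuot_circ_mul {n : Fin 3 → ℝ} (hn : dot σ n n = -Λ) (g : H σ Λ) :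
    projQuot n (circ g * g) = coreSq n g := by
  have hΛ : Λ = -(n 0 * n 0 + σ.sgn * n 1 * n 1 + σ.sgn * n 2 * n 2) := by
    rw [dot_eq] at hn; linarith
  have hv : ∑ a, n a • e a = (vec n : H σ Λ) := rfl
  rw [projQuot, hv]
  simp [proj, circ, conjTheta, conjR, coreSq, core_apply, thetaSub_eq, imTheta, vec_eq]
  cases σ <;> simp only [Signature.sgn] at hΛ ⊢
  · linear_combination (-(g.re.im ^ 2 + g.imI.im ^ 2 + g.imJ.im ^ 2 + g.imK.im ^ 2)) * hΛ
  · linear_combination (-(g.re.im ^ 2 + g.imI.im ^ 2 - g.imJ.im ^ 2 - g.imK.im ^ 2)) * hΛ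

theorem mem_F_iff {n : Fin 3 → ℝ} (hn : dot σ n n = -Λ) {g : H σ Λ} :
    g ∈ F σ Λ n ↔ g ∈ unitGroup σ Λ ∧ 0 < coreSq n g := by
  rw [← projQuot_circ_mul hn]; rfl

/-! ### Exponentials and the group `AN(2)_n` -/

open scoped Nat in
theorem exp_of_mul_self_eq {X : H σ Λ} {c : ℝ} (hc : c ≠ 0) (hX : X * X = (c ^ 2) • 1) :
    NormedSpace.exp X = Real.cosh c • 1 + (Real.sinh c / c) • X := by
  have heven : ∀ k : ℕ, X ^ (2 * k) = (c ^ (2 * k)) • 1 := fun k ↦ by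
    rw [pow_mul, pow_two, hX, smul_pow, one_pow, ← pow_mul]
  rw [NormedSpace.exp_eq_tsum ℝ]
  refine HasSum.tsum_eq (HasSum.even_add_odd ?_ ?_)
  · convert! (Real.hasSum_cosh c).smul_const (1 : H σ Λ) using 1
    ext1 k
    rw [heven, smul_smul]
    congr 1
    ring
  · convert! ((Real.hasSum_sinh c).div_const c).smul_const X using 1
    ext1 k
    rw [pow_succ, heven, smul_one_mul, smul_smul]
    congr 1
    field_simp
    exact (pow_succ c (2 * k)).symm

theorem exp_of_mul_self_eq_zero {X : H σ Λ} (hX : X * X = 0) : NormedSpace.exp X = 1 + X := by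
  rw [NormedSpace.exp_eq_tsum ℝ]
  refine (tsum_eq_sum (s := Finset.range 2) fun k hk ↦ ?_).trans ?_
  · obtain ⟨j, rfl⟩ := Nat.exists_eq_add_of_le (not_lt.1 (Finset.mem_range.not.1 hk))
    simp [pow_add, pow_two, hX]
  · simp [Finset.sum_range_succ]

/-- The Lie algebra element `q^a S_a`. -/
def sVec (n x : Fin 3 → ℝ) : H σ Λ := ∑ a, x a • S n a

theorem sVec_eq (n x : Fin 3 → ℝ) :
    (sVec n x : H σ Λ) = (1 / 2 : ℝ) •
      ⟨0, ⟨n 2 * x 1 - n 1 * x 2, x 0⟩,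
        ⟨σ.sgn * (n 0 * x 2 - n 2 * x 0), x 1⟩,
        ⟨σ.sgn * σ.sgn * (n 1 * x 0 - n 0 * x 1), σ.sgn * x 2⟩⟩ := by
  ext <;> simp [sVec, S, eUp, eps, eta, e, theta, Fin.sum_univ_three, Matrix.diagonal] <;> ring

theorem sVec_smul (n x : Fin 3 → ℝ) (r : ℝ) : (sVec n (r • x) : H σ Λ) = r • sVec n x := by
  simp [sVec, Finset.smul_sum, smul_smul]

theorem sVec_single (n : Fin 3 → ℝ) (a : Fin 3) : (sVec n (Pi.single a 1) : H σ Λ) = S n a := by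
  simp [sVec, Pi.single_apply]

theorem star_sVec (n x : Fin 3 → ℝ) : star (sVec n x : H σ Λ) = -sVec n x := by
  rw [sVec_eq]; ext <;> simp

/-- The element is half of `x × n + θ x`, and `x × n` is orthogonal to `x`. So its square is `-(|x ×
n|² + Λ |x|²) / 4`, and Lagrange's identity with `n · n = -Λ` leaves `(x · n)² / 4`. -/
theorem sVec_mul_self {n : Fin 3 → ℝ} (hn : dot σ n n = -Λ) (x : Fin 3 → ℝ) :
    (sVec n x * sVec n x : H σ Λ) = ((dot σ x n / 2) ^ 2) • 1 := by
  have hΛ : Λ = -(n 0 * n 0 + σ.sgn * n 1 * n 1 + σ.sgn * n 2 * n 2) := by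
    rw [dot_eq] at hn; linarith
  have hs := σ.sgn_mul_self
  ext <;> simp [sVec_eq, dot_eq] <;> grind

/-- As quaternions `x n = -x · n + x × n`, so the real part `x × n / 2` of `x^a S_a` cancels the
cross product in the core. This is the role of the `n`-dependent term of `S_a`. -/
theorem core_sVec {n : Fin 3 → ℝ} (x : Fin 3 → ℝ) :
    core n (sVec n x : H σ Λ) = (dot σ x n / 2) • 1 := by
  have hs := σ.sgn_mul_self
  ext <;> simp [sVec_eq, dot_eq, core_apply, imTheta, thetaSub_eq] <;> grind

theorem mul_star_of_star_eq_neg {X : H σ Λ} {r : ℝ} {c : ℝ} (hX : star X = -X)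
    (hXX : X * X = c • 1) : (r • 1 + X) * star (r • 1 + X) = (r ^ 2 - c) • 1 := by
  rw [star_add, hX, QuaternionAlgebra.star_smul', star_one]
  simp only [add_mul, mul_add, smul_mul_assoc, one_mul, mul_smul_comm, mul_one, mul_neg, hXX]
  module

theorem exp_mem_unitGroup {X : H σ Λ} (hX : star X = -X) :
    NormedSpace.exp X ∈ unitGroup σ Λ := by
  let : NormedAlgebra ℚ (H σ Λ) := .restrictScalars ℚ ℝ (H σ Λ)
  change _ * star _ = 1
  rw [NormedSpace.star_exp, hX, ← NormedSpace.exp_add_of_commute (Commute.refl X).neg_right]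
  simp

theorem mul_mem_unitGroup {g h : H σ Λ} (hg : g ∈ unitGroup σ Λ) (hh : h ∈ unitGroup σ Λ) :
    g * h ∈ unitGroup σ Λ := by
  change _ = _ at hg hh
  change _ * _ = _
  rw [star_mul, mul_assoc, ← mul_assoc h, hh, one_mul, hg]

theorem star_mul_self_of_mem {g : H σ Λ} (hg : g ∈ unitGroup σ Λ) : star g * g = 1 := by
  rw [star_comm_self']; exact hg

theorem star_mem_unitGroup {g : H σ Λ} (hg : g ∈ unitGroup σ Λ) : star g ∈ unitGroup σ Λ := by
  change _ * star (star g) = 1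
  rw [star_star, star_mul_self_of_mem hg]

/-- The element `√(1 + (q · n)² / 4) + q^a S_a` of `AN(2)_n` with coordinates `q`. -/
def anElt (n x : Fin 3 → ℝ) : H σ Λ := √(1 + dot σ x n ^ 2 / 4) • 1 + sVec n x

theorem dot_smul_left (r : ℝ) (x y : Fin 3 → ℝ) : dot σ (r • x) y = r * dot σ x y := by
  simp only [dot_eq, Pi.smul_apply, smul_eq_mul]; ring

theorem anElt_mem_AN2 {n : Fin 3 → ℝ} (hn : dot σ n n = -Λ) (x : Fin 3 → ℝ) :
    (anElt n x : H σ Λ) ∈ AN2 σ Λ n := by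
  suffices h : ∃ y, NormedSpace.exp (sVec n y : H σ Λ) = anElt n x by
    obtain ⟨y, hy⟩ := h
    exact Submonoid.subset_closure ⟨y, hy⟩
  set k := dot σ x n / 2 with hk
  have hroot : √(1 + dot σ x n ^ 2 / 4) = √(1 + k ^ 2) := by congr 1; rw [hk]; ring
  rcases eq_or_ne k 0 with h0 | h0
  · refine ⟨x, ?_⟩
    rw [exp_of_mul_self_eq_zero (by rw [sVec_mul_self hn, ← hk, h0]; simp), anElt, hroot, h0]
    simp
  -- A single exponential suffices: rescaling `x` turns half its product with `n` into `arsinh k`,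
  -- whose `sinh` and `cosh` are `k` and `√(1 + k²)`.
  · have ha : Real.arsinh k ≠ 0 := by simpa using h0
    have hd : dot σ ((Real.arsinh k / k) • x) n / 2 = Real.arsinh k := by
      rw [dot_smul_left, show dot σ x n = 2 * k by rw [hk]; ring]
      field_simp
    refine ⟨(Real.arsinh k / k) • x, ?_⟩
    rw [exp_of_mul_self_eq ha (by rw [sVec_mul_self hn, hd]), sVec_smul, smul_smul,
      Real.sinh_arsinh, Real.cosh_arsinh, anElt, hroot]
    congr 1
    rw [show k / Real.arsinh k * (Real.arsinh k / k) = 1 by field_simp, one_smul]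

theorem core_exp_sVec {n : Fin 3 → ℝ} (hn : dot σ n n = -Λ) (x : Fin 3 → ℝ) :
    core n (NormedSpace.exp (sVec n x : H σ Λ)) = Real.exp (dot σ x n / 2) • 1 := by
  set k := dot σ x n / 2 with hk
  rcases eq_or_ne k 0 with h0 | h0
  · rw [exp_of_mul_self_eq_zero (by rw [sVec_mul_self hn, ← hk, h0]; simp), map_add, core_sVec,
      core_one, ← hk, h0]
    simp
  · rw [exp_of_mul_self_eq h0 (by rw [sVec_mul_self hn]), map_add, map_smul, map_smul, core_sVec,
      core_one, ← hk, smul_smul, ← add_smul, div_mul_cancel₀ _ h0, Real.cosh_add_sinh]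

/-- The elements of `AN(2)_n` are unit quaternions with positive real core. -/
theorem core_of_mem_AN2 {n : Fin 3 → ℝ} (hn : dot σ n n = -Λ) {s : H σ Λ} (hs : s ∈ AN2 σ Λ n) :
    s ∈ unitGroup σ Λ ∧ ∃ m : ℝ, 0 < m ∧ core n s = m • 1 := by
  induction hs using Submonoid.closure_induction with
  | mem x hx =>
    obtain ⟨y, rfl⟩ := hx
    exact ⟨exp_mem_unitGroup (star_sVec n y), _, Real.exp_pos _, core_exp_sVec hn y⟩
  | one => exact ⟨by simp [unitGroup], 1, one_pos, by rw [core_one, one_smul]⟩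
  | mul x y _ _ hx hy =>
    obtain ⟨hx, m, hm, hxm⟩ := hx
    obtain ⟨hy, m', hm', hym⟩ := hy
    exact ⟨mul_mem_unitGroup hx hy, m' * m, mul_pos hm' hm, by
      rw [core_mul_of_core_eq_smul hn hym, hxm, smul_smul]⟩

/-- The coordinates `q^a = -2 Im_θ Π (s e^a)`. -/
def qOf (s : H σ Λ) : Fin 3 → ℝ := fun a ↦ -2 * (proj (s * eUp a)).im

theorem qOf_eq (s : H σ Λ) :
    qOf s = ![2 * s.imI.im, 2 * s.imJ.im, 2 * (σ.sgn * s.imK.im)] := by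
  have hs := σ.sgn_mul_self
  ext a
  fin_cases a <;> simp [qOf, proj, eUp_eq, vec_eq, eta, Matrix.diagonal] <;> grind

theorem qOf_anElt (n x : Fin 3 → ℝ) : qOf (anElt n x : H σ Λ) = x := by
  have hs := σ.sgn_mul_self
  ext a
  fin_cases a <;> simp [qOf_eq, anElt, sVec_eq] <;> grind

/-- Converse to `core_of_mem_AN2`: for `s = A + θ B` the core condition reads `A = m + B n`, so `s`
is determined by `B` and `m`, and the unit condition fixes the scalar part up to sign. -/
theorem eq_anElt {n : Fin 3 → ℝ} (hn : dot σ n n = -Λ) {s : H σ Λ} {m : ℝ}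
    (hs : s ∈ unitGroup σ Λ) (hm : 0 < m) (hc : core n s = m • 1) : s = anElt n (qOf s) := by
  have hss := σ.sgn_mul_self
  obtain ⟨⟨a, a'⟩, ⟨b, b'⟩, ⟨c, c'⟩, ⟨d, d'⟩⟩ := s
  have hu : _ * star _ = _ := hs
  have hc0 := congrArg (fun w ↦ w.re.re) hc
  have hc1 := congrArg (fun w ↦ w.imI.re) hc
  have hc2 := congrArg (fun w ↦ w.imJ.re) hc
  have hc3 := congrArg (fun w ↦ w.imK.re) hc
  have hu1 := congrArg (fun w ↦ w.re.im) hu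
  simp [core_apply, imTheta, thetaSub_eq] at hc0 hc1 hc2 hc3 hu1
  -- With `A = m + B n` the `θ`-component of `s s̄` is `A B̄ + B Ā = m (B + B̄) = 2 m a'`, and it
  -- vanishes for a unit.
  have ha' : a' = 0 := by
    have : m * a' = 0 := by grind
    simpa [hm.ne'] using this
  subst ha'
  set x := qOf (⟨⟨a, 0⟩, ⟨b, b'⟩, ⟨c, c'⟩, ⟨d, d'⟩⟩ : H σ Λ) with hx
  rw [qOf_eq] at hx
  have hform : (⟨⟨a, 0⟩, ⟨b, b'⟩, ⟨c, c'⟩, ⟨d, d'⟩⟩ : H σ Λ) = a • 1 + sVec n x := by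
    ext <;> simp [sVec_eq, hx] <;> grind
  have ham : a = m - dot σ x n / 2 := by
    simp [dot_eq, hx]; grind
  have hsq : a ^ 2 - (dot σ x n / 2) ^ 2 = 1 := by
    rw [hform, mul_star_of_star_eq_neg (star_sVec n x) (sVec_mul_self hn x)] at hu
    simpa using congrArg (fun w ↦ w.re.re) hu
  -- If `a < 0`, then `q · n / 2 = m - a > -a > 0`, which contradicts `a² - (q · n / 2)² = 1`.
  -- Positivity of the core thus selects the positive square root.
  have hpos : 0 ≤ a := by
    by_contra! h
    nlinarith
  rw [hform, anElt, show 1 + dot σ x n ^ 2 / 4 = a ^ 2 by linarith, Real.sqrt_sq hpos]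

/-! ### Existence and uniqueness of the factorisation -/

/-- The explicit formula for the factor in `ℍ₁`. -/
def uFun (n : Fin 3 → ℝ) (g : H σ Λ) : H σ Λ := (√(coreSq n g))⁻¹ • core n g

/-- The explicit formula for the factor in `AN(2)_n`. -/
def sFun (n : Fin 3 → ℝ) (g : H σ Λ) : H σ Λ := star (uFun n g) * g

theorem mul_star_of_conjTheta_eq {u : H σ Λ} (hu : conjTheta u = u) :
    u * star u = (u * star u).re.re • 1 := by
  obtain ⟨a, b, c, d, rfl⟩ := exists_of_conjTheta_eq hu
  ext <;> simp <;> ring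

theorem conjTheta_uFun (n : Fin 3 → ℝ) (g : H σ Λ) : conjTheta (uFun n g) = uFun n g :=
  conjTheta_smul (conjTheta_core n g) _

theorem uFun_mem {n : Fin 3 → ℝ} {g : H σ Λ} (hg : 0 < coreSq n g) :
    uFun n g ∈ realUnitGroup σ Λ := by
  refine ⟨?_, conjTheta_uFun n g⟩
  change _ * star _ = 1
  rw [uFun, QuaternionAlgebra.star_smul', smul_mul_smul_comm,
    mul_star_of_conjTheta_eq (conjTheta_core n g), ← coreSq, smul_smul, ← mul_inv,
    Real.mul_self_sqrt hg.le, inv_mul_cancel₀ hg.ne', one_smul]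

theorem uFun_mul_sFun {n : Fin 3 → ℝ} {g : H σ Λ} (hg : 0 < coreSq n g) :
    uFun n g * sFun n g = g := by
  have h : uFun n g * star (uFun n g) = 1 := (uFun_mem hg).1
  rw [sFun, ← mul_assoc, h, one_mul]

theorem core_eq_smul_uFun {n : Fin 3 → ℝ} {g : H σ Λ} (hg : 0 < coreSq n g) :
    core n g = √(coreSq n g) • uFun n g := by
  rw [uFun, smul_smul, mul_inv_cancel₀ (Real.sqrt_pos.2 hg).ne', one_smul]

theorem core_sFun {n : Fin 3 → ℝ} {g : H σ Λ} (hg : 0 < coreSq n g) :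
    core n (sFun n g) = √(coreSq n g) • 1 := by
  rw [sFun, core_mul_of_conjTheta_eq (conjTheta_star (conjTheta_uFun n g)), core_eq_smul_uFun hg,
    mul_smul_comm, star_mul_self_of_mem (uFun_mem hg).1]

theorem sFun_mem_unitGroup {n : Fin 3 → ℝ} {g : H σ Λ} (hg : 0 < coreSq n g)
    (hg' : g ∈ unitGroup σ Λ) : sFun n g ∈ unitGroup σ Λ :=
  mul_mem_unitGroup (star_mem_unitGroup (uFun_mem hg).1) hg'

theorem sFun_eq_anElt {n : Fin 3 → ℝ} (hn : dot σ n n = -Λ) {g : H σ Λ} (hg : g ∈ F σ Λ n) :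
    sFun n g = anElt n (qOf (sFun n g)) := by
  rw [mem_F_iff hn] at hg
  exact eq_anElt hn (sFun_mem_unitGroup hg.2 hg.1) (Real.sqrt_pos.2 hg.2) (core_sFun hg.2)

theorem isFactorisation {n : Fin 3 → ℝ} (hn : dot σ n n = -Λ) {g : H σ Λ} (hg : g ∈ F σ Λ n) :
    IsFactorisation n g (uFun n g, sFun n g) := by
  have hg' := (mem_F_iff hn).1 hg
  refine ⟨uFun_mem hg'.2, ?_, (uFun_mul_sFun hg'.2).symm⟩
  change sFun n g ∈ _
  rw [sFun_eq_anElt hn hg]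
  exact anElt_mem_AN2 hn _

/-- The core of `v t` is a positive multiple of `v`, and normalising it recovers `v`. -/
theorem IsFactorisation.eq {n : Fin 3 → ℝ} (hn : dot σ n n = -Λ) {g : H σ Λ}
    {us : H σ Λ × H σ Λ} (h : IsFactorisation n g us) : us = (uFun n g, sFun n g) := by
  obtain ⟨v, t⟩ := us
  obtain ⟨⟨hv, hv'⟩, ht, rfl⟩ := h
  obtain ⟨ht, m, hm, hc⟩ := core_of_mem_AN2 hn ht
  dsimp only at *
  have hcore : core n (v * t) = m • v := by
    rw [core_mul_of_conjTheta_eq hv', hc, mul_smul_comm, mul_one]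
  have hsq : coreSq n (v * t) = m ^ 2 := by
    have hv : v * star v = 1 := hv
    rw [coreSq, hcore, QuaternionAlgebra.star_smul', smul_mul_smul_comm, hv]
    simp [pow_two]
  have hu : uFun n (v * t) = v := by
    rw [uFun, hsq, hcore, Real.sqrt_sq hm.le, smul_smul, inv_mul_cancel₀ hm.ne', one_smul]
  rw [sFun, hu, ← mul_assoc, star_mul_self_of_mem hv, one_mul]

theorem existsUnique_isFactorisation {n : Fin 3 → ℝ} (hn : dot σ n n = -Λ) {g : H σ Λ}
    (hg : g ∈ F σ Λ n) : ∃! us, IsFactorisation n g us :=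
  ⟨_, isFactorisation hn hg, fun _ h ↦ h.eq hn⟩

theorem factors_eq {n : Fin 3 → ℝ} (hn : dot σ n n = -Λ) {g : H σ Λ} (hg : g ∈ F σ Λ n) :
    factors n g = (uFun n g, sFun n g) := by
  have h : ∃ us, IsFactorisation n g us := ⟨_, isFactorisation hn hg⟩
  rw [factors, dif_pos h]
  exact h.choose_spec.eq hn

theorem u_eq {n : Fin 3 → ℝ} (hn : dot σ n n = -Λ) {g : H σ Λ} (hg : g ∈ F σ Λ n) :
    u n g = uFun n g := congrArg Prod.fst (factors_eq hn hg)

theorem s_eq {n : Fin 3 → ℝ} (hn : dot σ n n = -Λ) {g : H σ Λ} (hg : g ∈ F σ Λ n) :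
    s n g = sFun n g := congrArg Prod.snd (factors_eq hn hg)

theorem u_mul_s {n : Fin 3 → ℝ} (hn : dot σ n n = -Λ) {g : H σ Λ} (hg : g ∈ F σ Λ n) :
    u n g * s n g = g := by
  rw [u_eq hn hg, s_eq hn hg, uFun_mul_sFun ((mem_F_iff hn).1 hg).2]

/-! ### The coordinate functions -/

/-- The coordinates `p^a = -2 Re_θ Π (u e^a)`. -/
def pOf (u : H σ Λ) : Fin 3 → ℝ := fun a ↦ -2 * (proj (u * eUp a)).re

theorem pOf_eq (u : H σ Λ) :
    pOf u = ![2 * u.imI.re, 2 * u.imJ.re, 2 * (σ.sgn * u.imK.re)] := by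
  have hs := σ.sgn_mul_self
  ext a
  fin_cases a <;> simp [pOf, proj, eUp_eq, vec_eq, eta, Matrix.diagonal] <;> grind

theorem p_eq {n : Fin 3 → ℝ} (hn : dot σ n n = -Λ) {g : H σ Λ} (hg : g ∈ F σ Λ n) (a : Fin 3) :
    p n a g = pOf (uFun n g) a := by rw [p, u_eq hn hg]; rfl

theorem q_eq {n : Fin 3 → ℝ} (hn : dot σ n n = -Λ) {g : H σ Λ} (hg : g ∈ F σ Λ n) (a : Fin 3) :
    q n a g = qOf (sFun n g) a := by rw [q, s_eq hn hg]; rfl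

theorem p3_eq {n : Fin 3 → ℝ} (hn : dot σ n n = -Λ) {g : H σ Λ} (hg : g ∈ F σ Λ n) :
    p3 n g = (uFun n g).re.re := by rw [p3, u_eq hn hg]; rfl

theorem qn_eq {n : Fin 3 → ℝ} (hn : dot σ n n = -Λ) {g : H σ Λ} (hg : g ∈ F σ Λ n) :
    qn n g = dot σ (qOf (sFun n g)) n := by
  rw [qn]; congr 1; ext a; exact q_eq hn hg a

/-- A real quaternion in terms of its coordinates. -/
theorem eq_smul_one_add_vec {u : H σ Λ} (hu : conjTheta u = u) :
    u = u.re.re • 1 + (1 / 2 : ℝ) • vec (pOf u) := by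
  have hs := σ.sgn_mul_self
  obtain ⟨a, b, c, d, rfl⟩ := exists_of_conjTheta_eq hu
  ext <;> simp [vec_eq, pOf_eq] <;> grind

theorem sq_add_dot_pOf {u : H σ Λ} (hu : u ∈ realUnitGroup σ Λ) :
    u.re.re ^ 2 + dot σ (pOf u) (pOf u) / 4 = 1 := by
  have hs := σ.sgn_mul_self
  obtain ⟨hu, hu'⟩ := hu
  obtain ⟨a, b, c, d, rfl⟩ := exists_of_conjTheta_eq hu'
  have h := congrArg (fun w : H σ Λ ↦ w.re.re) (show _ * star _ = _ from hu)
  simp [dot_eq, pOf_eq] at h ⊢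
  grind

theorem p3_eq_or {n : Fin 3 → ℝ} (hn : dot σ n n = -Λ) {g : H σ Λ} (hg : g ∈ F σ Λ n) :
    p3 n g = √(1 - dot σ (fun a ↦ p n a g) (fun a ↦ p n a g) / 4) ∨
      p3 n g = -√(1 - dot σ (fun a ↦ p n a g) (fun a ↦ p n a g) / 4) := by
  have hp : (fun a ↦ p n a g) = pOf (uFun n g) := funext (p_eq hn hg)
  have h := sq_add_dot_pOf (uFun_mem ((mem_F_iff hn).1 hg).2)
  rw [hp, p3_eq hn hg, show 1 - dot σ (pOf (uFun n g)) (pOf (uFun n g)) / 4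
    = (uFun n g).re.re ^ 2 by linarith, Real.sqrt_sq_eq_abs]
  rcases abs_choice (uFun n g).re.re with h | h <;> rw [h] <;> simp

/-! ### Smoothness -/

/-- `Re_θ Π` as a continuous linear map. -/
def reCLM : H σ Λ →L[ℝ] ℝ :=
  LinearMap.toContinuousLinearMap
    { toFun := fun g ↦ g.re.re
      map_add' := fun _ _ ↦ rfl
      map_smul' := fun _ _ ↦ rfl }

/-- `Im_θ Π` as a continuous linear map. -/
def imCLM : H σ Λ →L[ℝ] ℝ :=
  LinearMap.toContinuousLinearMap
    { toFun := fun g ↦ g.re.im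
      map_add' := fun _ _ ↦ rfl
      map_smul' := fun _ _ ↦ rfl }

@[simp] theorem reCLM_apply (g : H σ Λ) : reCLM g = g.re.re := rfl

@[simp] theorem imCLM_apply (g : H σ Λ) : imCLM g = g.re.im := rfl

/-- `core n` as a continuous linear map. -/
def coreCLM (n : Fin 3 → ℝ) : H σ Λ →L[ℝ] H σ Λ := LinearMap.toContinuousLinearMap (core n)

@[simp] theorem coreCLM_apply (n : Fin 3 → ℝ) (g : H σ Λ) : coreCLM n g = core n g := rfl

theorem contDiff_coreSq (n : Fin 3 → ℝ) : ContDiff ℝ ∞ (coreSq n : H σ Λ → ℝ) := by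
  have h1 : ContDiff ℝ ∞ (fun g : H σ Λ ↦ coreCLM n g) := (coreCLM n).contDiff
  have h2 : ContDiff ℝ ∞ (fun g : H σ Λ ↦ starCLM (coreCLM n g)) := starCLM.contDiff.comp h1
  exact reCLM.contDiff.comp (h1.mul h2)

theorem contDiffOn_uFun {n : Fin 3 → ℝ} (hn : dot σ n n = -Λ) :
    ContDiffOn ℝ ∞ (uFun n) (F σ Λ n) := by
  refine ContDiffOn.smul (ContDiffOn.inv ((contDiff_coreSq n).contDiffOn.sqrt ?_) ?_)
    (coreCLM n).contDiff.contDiffOn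
  · exact fun g hg ↦ ((mem_F_iff hn).1 hg).2.ne'
  · exact fun g hg ↦ (Real.sqrt_pos.2 ((mem_F_iff hn).1 hg).2).ne'

theorem contDiffOn_sFun {n : Fin 3 → ℝ} (hn : dot σ n n = -Λ) :
    ContDiffOn ℝ ∞ (sFun n) (F σ Λ n) :=
  (starCLM.contDiff.comp_contDiffOn (contDiffOn_uFun hn)).mul contDiffOn_id

theorem smoothOnF_p {n : Fin 3 → ℝ} (hn : dot σ n n = -Λ) (a : Fin 3) :
    SmoothOnF (σ := σ) (Λ := Λ) n (p n a) := by
  refine ContDiffOn.congr ?_ fun g hg ↦ p_eq hn hg a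
  exact contDiffOn_const.mul
    (reCLM.contDiff.comp_contDiffOn ((contDiffOn_uFun hn).mul contDiffOn_const))

theorem smoothOnF_q {n : Fin 3 → ℝ} (hn : dot σ n n = -Λ) (a : Fin 3) :
    SmoothOnF (σ := σ) (Λ := Λ) n (q n a) := by
  refine ContDiffOn.congr ?_ fun g hg ↦ q_eq hn hg a
  exact contDiffOn_const.mul
    (imCLM.contDiff.comp_contDiffOn ((contDiffOn_sFun hn).mul contDiffOn_const))

theorem smoothOnF_p3 {n : Fin 3 → ℝ} (hn : dot σ n n = -Λ) :
    SmoothOnF (σ := σ) (Λ := Λ) n (p3 n) :=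
  ContDiffOn.congr (reCLM.contDiff.comp_contDiffOn (contDiffOn_uFun hn)) fun _ hg ↦ p3_eq hn hg

theorem smoothOnF_q3 {n : Fin 3 → ℝ} (hn : dot σ n n = -Λ) :
    SmoothOnF (σ := σ) (Λ := Λ) n (q3 n) := by
  have hqn : ContDiffOn ℝ ∞ (qn n) (F σ Λ n) := by
    unfold qn dot
    exact ContDiffOn.sum fun a _ ↦ ContDiffOn.sum fun b _ ↦
      (contDiffOn_const.mul (smoothOnF_q hn a)).mul contDiffOn_const
  exact (contDiffOn_const.add ((hqn.pow 2).div_const 4)).sqrt fun g _ ↦ by positivity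

/-! ### Derivatives of the factors -/

open scoped Topology

theorem re_mul_comm (x y : H σ Λ) : (x * y).re = (y * x).re := by
  simp only [QuaternionAlgebra.re_mul]; ring

theorem re_star_eq (x : H σ Λ) : (star x).re = x.re := by simp

/-- The decomposition of a tangent vector `v` at `g = u s` as `u (Y s + t)`, where `Y` lies in the
Lie algebra of `ℍ₁` and `t` is tangent to `AN(2)_n` at `s`. -/
structure IsSplitting (n : Fin 3 → ℝ) (g v Y t : H σ Λ) : Prop where
  eq : v = uFun n g * (Y * sFun n g + t)
  conj : conjTheta Y = Y
  re : Y.re.re = 0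
  core_smul_one : ∃ c : ℝ, core n t = c • 1

theorem star_eq_neg_of_conjTheta_eq {Y : H σ Λ} (h : conjTheta Y = Y) (h0 : Y.re.re = 0) :
    star Y = -Y := by
  obtain ⟨a, b, c, d, rfl⟩ := exists_of_conjTheta_eq h
  ext <;> simp_all

/-- The core varies by `m u Y + c u`, where `m` is the norm of the core. The term `c u` is radial
and disappears under normalisation; `u Y` is tangent because `Y` is pure. -/
theorem IsSplitting.hasDerivAt_uFun {n : Fin 3 → ℝ} {g v Y t : H σ Λ}
    (h : IsSplitting n g v Y t) (hg : 0 < coreSq n g) {γ : ℝ → H σ Λ} (hγ : HasDerivAt γ v 0)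
    (hγ0 : γ 0 = g) : HasDerivAt (fun r ↦ uFun n (γ r)) (uFun n g * Y) 0 := by
  obtain ⟨c, hc⟩ := h.core_smul_one
  set m := √(coreSq n g) with hm
  have hm0 : 0 < m := Real.sqrt_pos.2 hg
  have huu : uFun n g * star (uFun n g) = 1 := (uFun_mem hg).1
  have hcv : core n v = m • (uFun n g * Y) + c • uFun n g := by
    rw [h.eq, core_mul_of_conjTheta_eq (conjTheta_uFun n g), map_add,
      core_mul_of_conjTheta_eq h.conj, core_sFun hg, hc, mul_add]
    simp [hm]
  have hcore : HasDerivAt (fun r ↦ core n (γ r)) (core n v) 0 :=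
    (coreCLM n).hasFDerivAt.comp_hasDerivAt 0 hγ
  have hsq : HasDerivAt (fun r ↦ coreSq n (γ r)) (2 * (c * m)) 0 := by
    have h1 := reCLM.hasFDerivAt.comp_hasDerivAt (0 : ℝ)
      (hcore.mul (starCLM.hasFDerivAt.comp_hasDerivAt (0 : ℝ) hcore))
    refine h1.congr_deriv ?_
    have h2 : (core n g * star (core n v)).re = (core n v * star (core n g)).re := by
      rw [← re_star_eq, star_mul, star_star]
    have h3 : (core n v * star (core n g)).re.re = c * m := by
      rw [hcv, core_eq_smul_uFun hg, ← hm, QuaternionAlgebra.star_smul', add_mul,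
        smul_mul_smul_comm, smul_mul_smul_comm, huu, QuaternionAlgebra.re_add,
        QuaternionAlgebra.re_smul, mul_assoc, re_mul_comm, mul_assoc,
        star_mul_self_of_mem (uFun_mem hg).1]
      simp [h.re]
    simp only [Function.comp_apply, starCLM_apply, hγ0, reCLM_apply, QuaternionAlgebra.re_add, h2,
      QuadraticAlgebra.re_add, h3]
    ring
  have hinv := (hsq.sqrt (by rw [hγ0]; exact hg.ne')).inv
    (by rw [hγ0]; exact (Real.sqrt_pos.2 hg).ne')
  refine (hinv.smul hcore).congr_deriv ?_
  simp only [hγ0, Pi.inv_apply]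
  rw [← hm, hcv, core_eq_smul_uFun hg, ← hm, smul_add, smul_smul, smul_smul, smul_smul, add_assoc,
    ← add_smul, inv_mul_cancel₀ hm0.ne', one_smul]
  convert add_zero _
  -- The radial part `c / m` cancels against the derivative of the inverse norm.
  rw [show m⁻¹ * c + -(2 * (c * m) / (2 * m)) / m ^ 2 * m = 0 by field_simp; ring, zero_smul]

/-- Product rule for `s = ū g`: since `Ȳ = -Y`, the contribution `-Y s` of `ū` cancels the `Y s` in
`ū v = Y s + t`. -/
theorem IsSplitting.hasDerivAt_sFun {n : Fin 3 → ℝ} {g v Y t : H σ Λ}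
    (h : IsSplitting n g v Y t) (hg : 0 < coreSq n g) {γ : ℝ → H σ Λ} (hγ : HasDerivAt γ v 0)
    (hγ0 : γ 0 = g) : HasDerivAt (fun r ↦ sFun n (γ r)) t 0 := by
  have h1 := (starCLM.hasFDerivAt.comp_hasDerivAt (0 : ℝ) (h.hasDerivAt_uFun hg hγ hγ0)).mul hγ
  refine h1.congr_deriv ?_
  have huu := star_mul_self_of_mem (uFun_mem hg).1
  simp only [Function.comp_apply, starCLM_apply, hγ0]
  rw [h.eq, star_mul, star_eq_neg_of_conjTheta_eq h.conj h.re, ← mul_assoc (star _), huu, one_mul,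
    mul_assoc, ← sFun]
  simp

/-- The explicit formulas for the coordinates are known only on `F(n)`; this makes them available
along curves in the group when derivatives are taken. -/
theorem eventually_mem_F {n : Fin 3 → ℝ} (hn : dot σ n n = -Λ) {g : H σ Λ} (hg : g ∈ F σ Λ n)
    {γ : ℝ → H σ Λ} (hγ : ContinuousAt γ 0) (hγ0 : γ 0 = g) (hγu : ∀ r, γ r ∈ unitGroup σ Λ) :
    ∀ᶠ r in 𝓝 0, γ r ∈ F σ Λ n := by
  have hcont : ContinuousAt (fun r ↦ coreSq n (γ r)) 0 :=
    (contDiff_coreSq n).continuous.continuousAt.comp hγ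
  have hpos : 0 < coreSq n (γ 0) := by rw [hγ0]; exact ((mem_F_iff hn).1 hg).2
  filter_upwards [hcont.eventually (lt_mem_nhds hpos)] with r hr
  exact (mem_F_iff hn).2 ⟨hγu r, hr⟩

theorem IsSplitting.deriv_p {n : Fin 3 → ℝ} (hn : dot σ n n = -Λ) {g v Y t : H σ Λ}
    (h : IsSplitting n g v Y t) (hg : g ∈ F σ Λ n) {γ : ℝ → H σ Λ} (hγ : HasDerivAt γ v 0)
    (hγ0 : γ 0 = g) (hγu : ∀ r, γ r ∈ unitGroup σ Λ) (a : Fin 3) :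
    deriv (fun r ↦ p n a (γ r)) 0 = pOf (uFun n g * Y) a := by
  have hev := eventually_mem_F hn hg hγ.continuousAt hγ0 hγu
  refine HasDerivAt.deriv (HasDerivAt.congr_of_eventuallyEq ?_
    (hev.mono fun r hr ↦ p_eq hn hr a))
  exact (reCLM.hasFDerivAt.comp_hasDerivAt (0 : ℝ)
    ((h.hasDerivAt_uFun ((mem_F_iff hn).1 hg).2 hγ hγ0).mul_const (eUp a))).const_mul (-2)

theorem IsSplitting.deriv_q {n : Fin 3 → ℝ} (hn : dot σ n n = -Λ) {g v Y t : H σ Λ}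
    (h : IsSplitting n g v Y t) (hg : g ∈ F σ Λ n) {γ : ℝ → H σ Λ} (hγ : HasDerivAt γ v 0)
    (hγ0 : γ 0 = g) (hγu : ∀ r, γ r ∈ unitGroup σ Λ) (a : Fin 3) :
    deriv (fun r ↦ q n a (γ r)) 0 = qOf t a := by
  have hev := eventually_mem_F hn hg hγ.continuousAt hγ0 hγu
  refine HasDerivAt.deriv (HasDerivAt.congr_of_eventuallyEq ?_
    (hev.mono fun r hr ↦ q_eq hn hr a))
  exact (imCLM.hasFDerivAt.comp_hasDerivAt (0 : ℝ)
    ((h.hasDerivAt_sFun ((mem_F_iff hn).1 hg).2 hγ hγ0).mul_const (eUp a))).const_mul (-2)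

theorem hasDerivAt_mul_exp (g X : H σ Λ) :
    HasDerivAt (fun r : ℝ ↦ g * NormedSpace.exp (r • X)) (g * X) 0 := by
  simpa using (hasDerivAt_exp_smul_const (𝕂 := ℝ) X 0).const_mul g

theorem hasDerivAt_exp_neg_mul (g X : H σ Λ) :
    HasDerivAt (fun r : ℝ ↦ NormedSpace.exp (-(r • X)) * g) (-X * g) 0 := by
  simpa using (hasDerivAt_exp_smul_const (𝕂 := ℝ) (-X) 0).mul_const g

theorem star_smul_eq_neg {X : H σ Λ} (hX : star X = -X) (r : ℝ) : star (r • X) = -(r • X) := by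
  rw [QuaternionAlgebra.star_smul', hX, smul_neg]

theorem mul_exp_mem_unitGroup {g X : H σ Λ} (hX : star X = -X) (hg : g ∈ unitGroup σ Λ) (r : ℝ) :
    g * NormedSpace.exp (r • X) ∈ unitGroup σ Λ :=
  mul_mem_unitGroup hg (exp_mem_unitGroup (star_smul_eq_neg hX r))

theorem exp_neg_mul_mem_unitGroup {g X : H σ Λ} (hX : star X = -X) (hg : g ∈ unitGroup σ Λ)
    (r : ℝ) : NormedSpace.exp (-(r • X)) * g ∈ unitGroup σ Λ :=
  mul_mem_unitGroup (exp_mem_unitGroup (by rw [star_neg, star_smul_eq_neg hX])) hg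

theorem IsSplitting.vecR_p {n : Fin 3 → ℝ} (hn : dot σ n n = -Λ) {g X Y t : H σ Λ}
    (h : IsSplitting n g (g * X) Y t) (hX : star X = -X) (hg : g ∈ F σ Λ n) (a : Fin 3) :
    vecR X (p n a) g = pOf (uFun n g * Y) a :=
  h.deriv_p hn hg (hasDerivAt_mul_exp g X) (by simp) (mul_exp_mem_unitGroup hX hg.1) a

theorem IsSplitting.vecR_q {n : Fin 3 → ℝ} (hn : dot σ n n = -Λ) {g X Y t : H σ Λ}
    (h : IsSplitting n g (g * X) Y t) (hX : star X = -X) (hg : g ∈ F σ Λ n) (a : Fin 3) :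
    vecR X (q n a) g = qOf t a :=
  h.deriv_q hn hg (hasDerivAt_mul_exp g X) (by simp) (mul_exp_mem_unitGroup hX hg.1) a

theorem IsSplitting.vecL_p {n : Fin 3 → ℝ} (hn : dot σ n n = -Λ) {g X Y t : H σ Λ}
    (h : IsSplitting n g (-X * g) Y t) (hX : star X = -X) (hg : g ∈ F σ Λ n) (a : Fin 3) :
    vecL X (p n a) g = pOf (uFun n g * Y) a :=
  h.deriv_p hn hg (hasDerivAt_exp_neg_mul g X) (by simp) (exp_neg_mul_mem_unitGroup hX hg.1) a

theorem IsSplitting.vecL_q {n : Fin 3 → ℝ} (hn : dot σ n n = -Λ) {g X Y t : H σ Λ}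
    (h : IsSplitting n g (-X * g) Y t) (hX : star X = -X) (hg : g ∈ F σ Λ n) (a : Fin 3) :
    vecL X (q n a) g = qOf t a :=
  h.deriv_q hn hg (hasDerivAt_exp_neg_mul g X) (by simp) (exp_neg_mul_mem_unitGroup hX hg.1) a

/-! ### The vector fields in coordinates -/

/-- The cross product `(x × y)^a = ε^{abc} x_b y_c`. -/
def cross (σ : Signature) (x y : Fin 3 → ℝ) : Fin 3 → ℝ :=
  ![x 1 * y 2 - x 2 * y 1, σ.sgn * (x 2 * y 0 - x 0 * y 2), σ.sgn * (x 0 * y 1 - x 1 * y 0)]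

theorem conjTheta_vec (x : Fin 3 → ℝ) : conjTheta (vec x : H σ Λ) = vec x := by
  rw [conjTheta_eq_iff, vec_eq]; simp

theorem star_vec (x : Fin 3 → ℝ) : star (vec x : H σ Λ) = -vec x := by
  rw [vec_eq]; ext <;> simp

/-- The Lie algebra element `x^a J_a`. -/
def jVec (x : Fin 3 → ℝ) : H σ Λ := (1 / 2 : ℝ) • vec x

theorem conjTheta_jVec (x : Fin 3 → ℝ) : conjTheta (jVec x : H σ Λ) = jVec x :=
  conjTheta_smul (conjTheta_vec x) _

theorem star_jVec (x : Fin 3 → ℝ) : star (jVec x : H σ Λ) = -jVec x := by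
  rw [jVec, QuaternionAlgebra.star_smul', star_vec, smul_neg]

theorem re_jVec (x : Fin 3 → ℝ) : (jVec x : H σ Λ).re = 0 := by
  simp [jVec, vec_eq]

theorem pOf_mul_jVec {v : H σ Λ} (hv : conjTheta v = v) (y : Fin 3 → ℝ) :
    pOf (v * jVec y) = v.re.re • y + (1 / 2 : ℝ) • cross σ (pOf v) y := by
  have hs := σ.sgn_mul_self
  obtain ⟨a, b, c, d, rfl⟩ := exists_of_conjTheta_eq hv
  ext i
  fin_cases i <;> simp [pOf_eq, jVec, vec_eq, cross] <;> grind

theorem pOf_jVec_mul {v : H σ Λ} (hv : conjTheta v = v) (y : Fin 3 → ℝ) :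
    pOf (jVec y * v) = v.re.re • y + (1 / 2 : ℝ) • cross σ y (pOf v) := by
  have hs := σ.sgn_mul_self
  obtain ⟨a, b, c, d, rfl⟩ := exists_of_conjTheta_eq hv
  ext i
  fin_cases i <;> simp [pOf_eq, jVec, vec_eq, cross] <;> grind

/-- `pOf` reads off `θ`-free components, and the `θ`-free part of `x^a S_a` is `(x × n)^a J_a`. -/
theorem pOf_mul_sVec {v : H σ Λ} (hv : conjTheta v = v) (n x : Fin 3 → ℝ) :
    pOf (v * sVec n x) = pOf (v * jVec (cross σ x n)) := by
  have hs := σ.sgn_mul_self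
  obtain ⟨a, b, c, d, rfl⟩ := exists_of_conjTheta_eq hv
  ext i
  fin_cases i <;> simp [pOf_eq, jVec, vec_eq, sVec_eq, cross] <;> grind

theorem pOf_sVec_mul {v : H σ Λ} (hv : conjTheta v = v) (n x : Fin 3 → ℝ) :
    pOf (sVec n x * v) = pOf (jVec (cross σ x n) * v) := by
  have hs := σ.sgn_mul_self
  obtain ⟨a, b, c, d, rfl⟩ := exists_of_conjTheta_eq hv
  ext i
  fin_cases i <;> simp [pOf_eq, jVec, vec_eq, sVec_eq, cross] <;> grind

theorem core_anElt {n : Fin 3 → ℝ} (x : Fin 3 → ℝ) :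
    core n (anElt n x : H σ Λ) = (√(1 + dot σ x n ^ 2 / 4) + dot σ x n / 2) • 1 := by
  rw [anElt, map_add, map_smul, core_one, core_sVec, ← add_smul]

theorem qOf_sub (x y : H σ Λ) : qOf (x - y) = qOf x - qOf y := by
  ext i; fin_cases i <;> simp [qOf_eq] <;> ring

theorem qOf_neg (x : H σ Λ) : qOf (-x) = -qOf x := by
  ext i; fin_cases i <;> simp [qOf_eq]

theorem pOf_sub (x y : H σ Λ) : pOf (x - y) = pOf x - pOf y := by
  ext i; fin_cases i <;> simp [pOf_eq] <;> ring

theorem pOf_neg (x : H σ Λ) : pOf (-x) = -pOf x := by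
  ext i; fin_cases i <;> simp [pOf_eq]

theorem qOf_anElt_mul_sVec {n : Fin 3 → ℝ} (y x : Fin 3 → ℝ) :
    qOf (anElt n y * sVec n x : H σ Λ)
      = (√(1 + dot σ y n ^ 2 / 4) + dot σ y n / 2) • x - (dot σ x n / 2) • y := by
  have hs := σ.sgn_mul_self
  rw [anElt]
  generalize √(1 + dot σ y n ^ 2 / 4) = r
  ext i
  fin_cases i <;> simp [qOf_eq, sVec_eq, dot_eq] <;> grind

theorem qOf_sVec_mul_anElt {n : Fin 3 → ℝ} (y x : Fin 3 → ℝ) :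
    qOf (sVec n x * anElt n y : H σ Λ)
      = (√(1 + dot σ y n ^ 2 / 4) - dot σ y n / 2) • x + (dot σ x n / 2) • y := by
  have hs := σ.sgn_mul_self
  rw [anElt]
  generalize √(1 + dot σ y n ^ 2 / 4) = r
  ext i
  fin_cases i <;> simp [qOf_eq, sVec_eq, dot_eq] <;> grind

theorem qOf_anElt_mul_jVec {n : Fin 3 → ℝ} (y x : Fin 3 → ℝ) :
    qOf (anElt n y * jVec x : H σ Λ) = (1 / 2 : ℝ) • cross σ y x := by
  have hs := σ.sgn_mul_self
  rw [anElt]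
  generalize √(1 + dot σ y n ^ 2 / 4) = r
  ext i
  fin_cases i <;> simp [qOf_eq, sVec_eq, jVec, vec_eq, cross] <;> grind

theorem qOf_jVec_mul_anElt {n : Fin 3 → ℝ} (y x : Fin 3 → ℝ) :
    qOf (jVec x * anElt n y : H σ Λ) = (1 / 2 : ℝ) • cross σ x y := by
  have hs := σ.sgn_mul_self
  rw [anElt]
  generalize √(1 + dot σ y n ^ 2 / 4) = r
  ext i
  fin_cases i <;> simp [qOf_eq, sVec_eq, jVec, vec_eq, cross] <;> grind

theorem core_anElt_mul_jVec {n : Fin 3 → ℝ} (y x : Fin 3 → ℝ) :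
    core n (anElt n y * jVec x : H σ Λ) = (-(1 / 2) * dot σ y (cross σ n x)) • 1 +
      jVec ((√(1 + dot σ y n ^ 2 / 4) - dot σ y n / 2) • x + dot σ y x • n) := by
  have hs := σ.sgn_mul_self
  rw [anElt]
  generalize √(1 + dot σ y n ^ 2 / 4) = r
  ext <;> simp [core_apply, imTheta, thetaSub_eq, sVec_eq, jVec, vec_eq, cross, dot_eq] <;> grind

/-- The rotation `x ↦ ū x u` of `ℝ³`. -/
def adj (σ : Signature) (p₃ : ℝ) (y x : Fin 3 → ℝ) : Fin 3 → ℝ :=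
  fun i ↦ (p₃ ^ 2 - dot σ y y / 4) * x i + p₃ * cross σ x y i + dot σ x y / 2 * y i

theorem star_mul_jVec_mul {v : H σ Λ} (hv : conjTheta v = v) (x : Fin 3 → ℝ) :
    star v * jVec x * v = jVec (adj σ v.re.re (pOf v) x) := by
  have hs := σ.sgn_mul_self
  obtain ⟨a, b, c, d, rfl⟩ := exists_of_conjTheta_eq hv
  ext <;> simp [pOf_eq, jVec, vec_eq, cross, adj, dot_eq] <;> grind

theorem sVec_eq_jVec (n x : Fin 3 → ℝ) :
    (sVec n x : H σ Λ) = jVec (cross σ x n) + theta Λ • jVec x := by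
  have hs := σ.sgn_mul_self
  ext <;> simp [sVec_eq, jVec, vec_eq, cross, theta] <;> grind

/-! ### Splittings of left and right translations -/

section Splitting

variable {n : Fin 3 → ℝ} {g : H σ Λ}

theorem q3_eq (hn : dot σ n n = -Λ) (hg : g ∈ F σ Λ n) :
    q3 n g = √(1 + dot σ (qOf (sFun n g)) n ^ 2 / 4) := by rw [q3, qn_eq hn hg]

theorem isSplitting_mul_sVec (hn : dot σ n n = -Λ) (hg : g ∈ F σ Λ n) (x : Fin 3 → ℝ) :
    IsSplitting n g (g * sVec n x) 0 (sFun n g * sVec n x) where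
  eq := by
    rw [zero_mul, zero_add, ← mul_assoc, uFun_mul_sFun ((mem_F_iff hn).1 hg).2]
  conj := by simp [conjTheta, conjR]; rfl
  re := rfl
  core_smul_one := by
    have hg' := ((mem_F_iff hn).1 hg).2
    refine ⟨dot σ x n / 2 * √(coreSq n g), ?_⟩
    rw [core_mul_of_core_eq_smul hn (core_sVec x), core_sFun hg', smul_smul]

theorem isSplitting_jVec_mul (hn : dot σ n n = -Λ) (hg : g ∈ F σ Λ n) (x : Fin 3 → ℝ) :
    IsSplitting n g (-jVec x * g)
      (-jVec (adj σ (uFun n g).re.re (pOf (uFun n g)) x)) 0 where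
  eq := by
    have hg' := ((mem_F_iff hn).1 hg).2
    have huu : uFun n g * star (uFun n g) = 1 := (uFun_mem hg').1
    rw [← star_mul_jVec_mul (conjTheta_uFun n g), add_zero, neg_mul, neg_mul, mul_neg,
      mul_assoc (_ * _), uFun_mul_sFun hg', mul_assoc, ← mul_assoc, huu, one_mul]
  conj := by rw [← neg_one_smul ℝ]; exact conjTheta_smul (conjTheta_jVec _) _
  re := by simp [re_jVec]
  core_smul_one := ⟨0, by simp⟩

/-- The vector `y` is forced: `core n (s X)`, with `X = x^a J_a`, has pure part `(α x + (q · x) n)^a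
J_a`, and subtracting `y^a J_a s` removes `q₃ + q · n / 2` times `y^a J_a`. What remains of the core
is a scalar. -/
theorem isSplitting_mul_jVec (hn : dot σ n n = -Λ) (hg : g ∈ F σ Λ n)
    (x : Fin 3 → ℝ) {y : Fin 3 → ℝ}
    {α : ℝ} (hα : α = q3 n g - qn n g / 2)
    (hy : y = α • (α • x + dot σ (qOf (sFun n g)) x • n)) :
    IsSplitting n g (g * jVec x) (jVec y) (sFun n g * jVec x - jVec y * sFun n g) where
  eq := by
    rw [add_sub_cancel, ← mul_assoc, uFun_mul_sFun ((mem_F_iff hn).1 hg).2]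
  conj := conjTheta_jVec _
  re := by simp [re_jVec]
  core_smul_one := by
    -- Difference of squares in `q₃² - (q · n)² / 4 = 1`; hence division by `q₃ + q · n / 2` becomes
    -- multiplication by `α`.
    have hm : α * (q3 n g + qn n g / 2) = 1 := by
      have := Real.sq_sqrt (show 0 ≤ 1 + qn n g ^ 2 / 4 by positivity)
      rw [← q3] at this
      rw [hα]; linear_combination this
    refine ⟨-(1 / 2) * dot σ (qOf (sFun n g)) (cross σ n x), ?_⟩
    rw [map_sub, core_mul_of_conjTheta_eq (conjTheta_jVec y), sFun_eq_anElt hn hg,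
      core_anElt_mul_jVec, core_anElt, hy, ← q3_eq hn hg, ← qn_eq hn hg, qOf_anElt, ← hα,
      mul_smul_comm, mul_one, add_sub_assoc]
    convert add_zero _
    rw [sub_eq_zero, jVec, jVec, vec, vec]
    simp only [Finset.smul_sum, smul_smul, Pi.smul_apply, smul_eq_mul]
    refine Finset.sum_congr rfl fun i _ ↦ ?_
    congr 1
    linear_combination (-(1 / 2) * (α • x + dot σ (qOf (sFun n g)) x • n) i) * hm

/-- Conjugation by `u` rotates the `θ`-part of `x^a S_a` into that of `x'^a S_a`. The two elements
differ by a real pure quaternion, which is the `Y` of the splitting. -/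
theorem isSplitting_sVec_mul (hn : dot σ n n = -Λ) (hg : g ∈ F σ Λ n)
    (x : Fin 3 → ℝ) {x' : Fin 3 → ℝ}
    (hx' : x' = adj σ (uFun n g).re.re (pOf (uFun n g)) x) :
    IsSplitting n g (-sVec n x * g)
      (sVec n x' - star (uFun n g) * sVec n x * uFun n g) (-(sVec n x' * sFun n g)) := by
  have hg' := ((mem_F_iff hn).1 hg).2
  have huu : uFun n g * star (uFun n g) = 1 := (uFun_mem hg').1
  have hY : sVec n x' - star (uFun n g) * sVec n x * uFun n g =
      jVec (cross σ x' n) - star (uFun n g) * jVec (cross σ x n) * uFun n g := by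
    rw [sVec_eq_jVec, sVec_eq_jVec, hx', ← star_mul_jVec_mul (conjTheta_uFun n g)]
    simp [mul_add, add_mul]
  have hY' : ∃ z, sVec n x' - star (uFun n g) * sVec n x * uFun n g = jVec z := by
    rw [hY, star_mul_jVec_mul (conjTheta_uFun n g)]
    exact ⟨cross σ x' n - adj σ (uFun n g).re.re (pOf (uFun n g)) (cross σ x n),
      by simp [jVec, vec, sub_smul, smul_sub]⟩
  obtain ⟨z, hz⟩ := hY'
  refine ⟨?_, by rw [hz]; exact conjTheta_jVec _, by rw [hz, re_jVec]; rfl, ?_⟩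
  · nth_rw 1 [← uFun_mul_sFun hg']
    simp only [sub_mul, mul_add, mul_sub, mul_assoc, mul_neg, neg_mul]
    rw [← mul_assoc (uFun n g) (star _), huu]
    simp only [one_mul]
    abel
  · refine ⟨-(√(coreSq n g) * (dot σ x' n / 2)), ?_⟩
    rw [map_neg, core_mul_of_core_eq_smul hn (core_sFun hg'), core_sVec, smul_smul, neg_smul]

end Splitting

theorem S_eq (n : Fin 3 → ℝ) (c : Fin 3) : (S n c : H σ Λ) = sVec n (Pi.single c 1) :=
  (sVec_single n c).symm

theorem JUp_eq (c : Fin 3) : (JUp c : H σ Λ) = jVec (eta σ c) := by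
  simp [JUp, J, jVec, vec, Finset.smul_sum, smul_smul, mul_comm]

theorem pOf_zero : pOf (0 : H σ Λ) = 0 := by
  ext i; fin_cases i <;> simp [pOf_eq]

theorem qOf_zero : qOf (0 : H σ Λ) = 0 := by
  ext i; fin_cases i <;> simp [qOf_eq]

/-- The variation of `p` under `x^a J_a` acting from the left. -/
def leftJp (σ : Signature) (p₃ : ℝ) (P x : Fin 3 → ℝ) : Fin 3 → ℝ :=
  fun i ↦ -(p₃ * x i + 1 / 2 * cross σ x P i)

/-- The variation of `p` when `u` is multiplied by an infinitesimal rotation from the right. -/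
def rightJp (σ : Signature) (p₃ : ℝ) (P x : Fin 3 → ℝ) : Fin 3 → ℝ :=
  fun i ↦ p₃ * x i + 1 / 2 * cross σ P x i

/-- The `ℍ₁`-part of `s x s⁻¹`. -/
def dress (σ : Signature) (α : ℝ) (Q n x : Fin 3 → ℝ) : Fin 3 → ℝ :=
  fun i ↦ α * (α * x i + dot σ Q x * n i)

/-! ### Derivatives of `p` and `q` along the generators -/

section Table

variable {n : Fin 3 → ℝ} {g : H σ Λ}

theorem vecR_S_p (hn : dot σ n n = -Λ) (hg : g ∈ F σ Λ n) (a c : Fin 3) :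
    vecR (S n c) (p n a) g = 0 := by
  rw [S_eq, (isSplitting_mul_sVec hn hg _).vecR_p hn (star_sVec n _) hg, mul_zero, pOf_zero]
  rfl

theorem vecR_S_q (hn : dot σ n n = -Λ) (hg : g ∈ F σ Λ n) (a c : Fin 3) :
    vecR (S n c) (q n a) g = (q3 n g + qn n g / 2) * (Pi.single c 1 : Fin 3 → ℝ) a
      - dot σ (Pi.single c 1) n / 2 * q n a g := by
  rw [S_eq, (isSplitting_mul_sVec hn hg _).vecR_q hn (star_sVec n _) hg, q_eq hn hg,
    sFun_eq_anElt hn hg, qOf_anElt_mul_sVec, q3_eq hn hg, qn_eq hn hg, qOf_anElt]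
  rfl

theorem vecL_J_p (hn : dot σ n n = -Λ) (hg : g ∈ F σ Λ n) (a c : Fin 3) :
    vecL (JUp c) (p n a) g = leftJp σ (p3 n g) (fun i ↦ p n i g) (eta σ c) a := by
  have huu : uFun n g * star (uFun n g) = 1 := (uFun_mem ((mem_F_iff hn).1 hg).2).1
  rw [JUp_eq, (isSplitting_jVec_mul hn hg _).vecL_p hn (star_jVec _) hg,
    ← star_mul_jVec_mul (conjTheta_uFun n g), mul_neg, mul_assoc, ← mul_assoc, huu, one_mul,
    pOf_neg, pOf_jVec_mul (conjTheta_uFun n g), p3_eq hn hg, funext (p_eq hn hg)]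
  rfl

theorem vecL_J_q (hn : dot σ n n = -Λ) (hg : g ∈ F σ Λ n) (a c : Fin 3) :
    vecL (JUp c) (q n a) g = 0 := by
  rw [JUp_eq, (isSplitting_jVec_mul hn hg _).vecL_q hn (star_jVec _) hg, qOf_zero]
  rfl

theorem vecR_J_p (hn : dot σ n n = -Λ) (hg : g ∈ F σ Λ n) (a c : Fin 3) :
    vecR (JUp c) (p n a) g = rightJp σ (p3 n g) (fun i ↦ p n i g)
      (dress σ (q3 n g - qn n g / 2) (fun i ↦ q n i g) n (eta σ c)) a := by
  rw [JUp_eq, (isSplitting_mul_jVec hn hg _ rfl rfl).vecR_p hn (star_jVec _) hg,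
    pOf_mul_jVec (conjTheta_uFun n g), p3_eq hn hg, funext (p_eq hn hg), funext (q_eq hn hg)]
  rfl

theorem vecR_J_q (hn : dot σ n n = -Λ) (hg : g ∈ F σ Λ n) (a c : Fin 3) :
    vecR (JUp c) (q n a) g = 1 / 2 * cross σ (fun i ↦ q n i g) (eta σ c) a
      - 1 / 2 * cross σ (dress σ (q3 n g - qn n g / 2) (fun i ↦ q n i g) n (eta σ c))
        (fun i ↦ q n i g) a := by
  rw [JUp_eq, (isSplitting_mul_jVec hn hg _ rfl rfl).vecR_q hn (star_jVec _) hg, qOf_sub,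
    funext (q_eq hn hg)]
  nth_rw 1 3 [sFun_eq_anElt hn hg]
  rw [qOf_anElt_mul_jVec, qOf_jVec_mul_anElt]
  rfl

theorem vecL_S_p (hn : dot σ n n = -Λ) (hg : g ∈ F σ Λ n) (a c : Fin 3) :
    vecL (S n c) (p n a) g = rightJp σ (p3 n g) (fun i ↦ p n i g)
      (cross σ (adj σ (p3 n g) (fun i ↦ p n i g) (Pi.single c 1)) n) a
      + leftJp σ (p3 n g) (fun i ↦ p n i g) (cross σ (Pi.single c 1) n) a := by
  have huu : uFun n g * star (uFun n g) = 1 := (uFun_mem ((mem_F_iff hn).1 hg).2).1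
  rw [S_eq, (isSplitting_sVec_mul hn hg _ rfl).vecL_p hn (star_sVec n _) hg, mul_sub, mul_assoc,
    ← mul_assoc, huu, one_mul, pOf_sub, pOf_mul_sVec (conjTheta_uFun n g),
    pOf_sVec_mul (conjTheta_uFun n g), pOf_mul_jVec (conjTheta_uFun n g),
    pOf_jVec_mul (conjTheta_uFun n g), p3_eq hn hg, funext (p_eq hn hg)]
  exact sub_eq_add_neg _ _

theorem vecL_S_q (hn : dot σ n n = -Λ) (hg : g ∈ F σ Λ n) (a c : Fin 3) :
    vecL (S n c) (q n a) g =
      -((q3 n g - qn n g / 2) * adj σ (p3 n g) (fun i ↦ p n i g) (Pi.single c 1) a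
        + dot σ (adj σ (p3 n g) (fun i ↦ p n i g) (Pi.single c 1)) n / 2 * q n a g) := by
  rw [S_eq, (isSplitting_sVec_mul hn hg _ rfl).vecL_q hn (star_sVec n _) hg, qOf_neg,
    q_eq hn hg, sFun_eq_anElt hn hg, qOf_sVec_mul_anElt, q3_eq hn hg, qn_eq hn hg, qOf_anElt,
    p3_eq hn hg, funext (p_eq hn hg)]
  rfl

theorem p3_sq (hn : dot σ n n = -Λ) (hg : g ∈ F σ Λ n) :
    p3 n g ^ 2 + dot σ (fun i ↦ p n i g) (fun i ↦ p n i g) / 4 = 1 := by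
  rw [p3_eq hn hg, funext (p_eq hn hg)]
  exact sq_add_dot_pOf (uFun_mem ((mem_F_iff hn).1 hg).2)

theorem q3_sq (n : Fin 3 → ℝ) (g : H σ Λ) : q3 n g ^ 2 = 1 + qn n g ^ 2 / 4 :=
  Real.sq_sqrt (by positivity)

end Table

/-! ### Identities for the brackets -/

/-- Multiplying `u` by `J` on the left is multiplying it on the right by the rotated `J`, and the
rotation is orthogonal for `η`, so the two rotations contract to the identity. -/
theorem sum_adj_mul_leftJp (p₃ : ℝ) (P : Fin 3 → ℝ) (hP : p₃ ^ 2 + dot σ P P / 4 = 1)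
    (a b : Fin 3) :
    ∑ c, adj σ p₃ P (Pi.single c 1) b * leftJp σ p₃ P (eta σ c) a
      = -rightJp σ p₃ P (eta σ b) a := by
  -- Inserting the factor `p₃² + p · p / 4 = 1` makes both sides homogeneous cubic in `(p₃, P)`, so
  -- the identity holds without the constraint.
  suffices h : ∑ c, adj σ p₃ P (Pi.single c 1) b * leftJp σ p₃ P (eta σ c) a
      = -rightJp σ p₃ P (eta σ b) a * (p₃ ^ 2 + dot σ P P / 4) by rw [h, hP, mul_one]
  cases σ <;> fin_cases a <;> fin_cases b <;>
    simp [Fin.sum_univ_three, adj, leftJp, rightJp, cross, dot_eq, eta, Matrix.diagonal,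
      Signature.sgn] <;> ring

/-- With `α = q₃ - q · n / 2` and `β = q₃ + q · n / 2`, the relations `α β = 1` and `α + q · n = β`
reduce everything to `α η + Q n / 2`. -/
theorem sum_mul_dress {n Q : Fin 3 → ℝ} {q₃ : ℝ} (hQ : q₃ ^ 2 = 1 + dot σ Q n ^ 2 / 4)
    (b d : Fin 3) :
    ∑ c, ((q₃ + dot σ Q n / 2) * (Pi.single c 1 : Fin 3 → ℝ) b
        - dot σ (Pi.single c 1) n / 2 * Q b) * dress σ (q₃ - dot σ Q n / 2) Q n (eta σ c) d
      = (q₃ - dot σ Q n / 2) * eta σ b d + 1 / 2 * Q b * n d := by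
  generalize hk : dot σ Q n = k at *
  rw [dot_eq] at hk
  cases σ <;> fin_cases b <;> fin_cases d <;>
    simp [Fin.sum_univ_three, dress, dot_eq, eta, Matrix.diagonal,
      Signature.sgn] at hk ⊢ <;> grind

theorem sum_mul_rightJp (p₃ : ℝ) (P w : Fin 3 → ℝ) (x : Fin 3 → Fin 3 → ℝ) (a : Fin 3) :
    ∑ c, w c * rightJp σ p₃ P (x c) a = rightJp σ p₃ P (fun d ↦ ∑ c, w c * x c d) a := by
  fin_cases a <;> simp [rightJp, cross, Fin.sum_univ_three] <;> ring

theorem sum_mul_cross (P w : Fin 3 → ℝ) (x : Fin 3 → Fin 3 → ℝ) (a : Fin 3) :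
    ∑ c, w c * cross σ (x c) P a = cross σ (fun d ↦ ∑ c, w c * x c d) P a := by
  fin_cases a <;> simp [cross, Fin.sum_univ_three] <;> ring

theorem rightJp_cross (p₃ : ℝ) (P x n : Fin 3 → ℝ) (a : Fin 3) :
    rightJp σ p₃ P (cross σ x n) a = ∑ d, x d * rightJp σ p₃ P (cross σ (Pi.single d 1) n) a := by
  fin_cases a <;> simp [rightJp, cross, Fin.sum_univ_three] <;> ring

/-- The first summand is linear in the rotated basis vector, so `sum_adj_mul_leftJp` removes the
rotation and leaves a difference of left and right terms, both quadratic in `(p₃, P)`. -/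
theorem sum_leftS_leftJ (p₃ : ℝ) (P n : Fin 3 → ℝ) (hP : p₃ ^ 2 + dot σ P P / 4 = 1)
    (a b : Fin 3) :
    ∑ c, (rightJp σ p₃ P (cross σ (adj σ p₃ P (Pi.single c 1)) n) a
        + leftJp σ p₃ P (cross σ (Pi.single c 1) n) a) * leftJp σ p₃ P (eta σ c) b
      = ∑ d, (leftJp σ p₃ P (cross σ (Pi.single d 1) n) a * leftJp σ p₃ P (eta σ d) b
          - rightJp σ p₃ P (cross σ (Pi.single d 1) n) a * rightJp σ p₃ P (eta σ d) b) := by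
  have h : ∀ d, ∑ c, adj σ p₃ P (Pi.single c 1) d * leftJp σ p₃ P (eta σ c) b
      = -rightJp σ p₃ P (eta σ d) b := fun d ↦ sum_adj_mul_leftJp p₃ P hP b d
  simp only [rightJp_cross p₃ P (adj σ p₃ P _), add_mul, Finset.sum_add_distrib,
    Finset.sum_sub_distrib, Finset.sum_mul]
  rw [Finset.sum_comm, add_comm, sub_eq_add_neg, ← Finset.sum_neg_distrib]
  congr 1
  refine Finset.sum_congr rfl fun d _ ↦ ?_
  rw [← mul_neg, ← h d, Finset.mul_sum]
  exact Finset.sum_congr rfl fun c _ ↦ by ring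

theorem leftS_wedge_leftJ (p₃ : ℝ) (P n : Fin 3 → ℝ) (hP : p₃ ^ 2 + dot σ P P / 4 = 1)
    (a b : Fin 3) :
    ∑ c, ((rightJp σ p₃ P (cross σ (adj σ p₃ P (Pi.single c 1)) n) a
        + leftJp σ p₃ P (cross σ (Pi.single c 1) n) a) * leftJp σ p₃ P (eta σ c) b
      - (rightJp σ p₃ P (cross σ (adj σ p₃ P (Pi.single c 1)) n) b
        + leftJp σ p₃ P (cross σ (Pi.single c 1) n) b) * leftJp σ p₃ P (eta σ c) a)
      = 2 * (p₃ * (n a * P b - P a * n b)) := by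
  rw [Finset.sum_sub_distrib, sum_leftS_leftJ p₃ P n hP, sum_leftS_leftJ p₃ P n hP]
  cases σ <;> fin_cases a <;> fin_cases b <;>
    simp [Fin.sum_univ_three, leftJp, rightJp, cross, eta, Matrix.diagonal, Signature.sgn,
      -zero_eq_mul, -mul_eq_zero] <;> ring

theorem rightS_mul_rightJ_p {p₃ q₃ : ℝ} {P Q n : Fin 3 → ℝ} (hQ : q₃ ^ 2 = 1 + dot σ Q n ^ 2 / 4)
    (a b : Fin 3) :
    ∑ c, ((q₃ + dot σ Q n / 2) * (Pi.single c 1 : Fin 3 → ℝ) b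
        - dot σ (Pi.single c 1) n / 2 * Q b) *
          rightJp σ p₃ P (dress σ (q₃ - dot σ Q n / 2) Q n (eta σ c)) a
      = rightJp σ p₃ P (fun d ↦ (q₃ - dot σ Q n / 2) * eta σ b d + 1 / 2 * Q b * n d) a := by
  rw [sum_mul_rightJp]
  simp_rw [sum_mul_dress hQ]

/-- The result is the vector of `rightS_mul_rightJ_p`: left and right translations contribute
equally to the mixed bracket of `p` and `q`. They cancel in the Sklyanin bracket and add up in the
dual one. -/
theorem leftS_mul_leftJ {p₃ q₃ : ℝ} {P Q n : Fin 3 → ℝ} (hP : p₃ ^ 2 + dot σ P P / 4 = 1)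
    (a b : Fin 3) :
    ∑ c, -((q₃ - dot σ Q n / 2) * adj σ p₃ P (Pi.single c 1) b
        + dot σ (adj σ p₃ P (Pi.single c 1)) n / 2 * Q b) * leftJp σ p₃ P (eta σ c) a
      = rightJp σ p₃ P (fun d ↦ (q₃ - dot σ Q n / 2) * eta σ b d + 1 / 2 * Q b * n d) a := by
  have h1 : rightJp σ p₃ P (fun d ↦ (q₃ - dot σ Q n / 2) * eta σ b d + 1 / 2 * Q b * n d) a
      = (q₃ - dot σ Q n / 2) * rightJp σ p₃ P (eta σ b) a
        + 1 / 2 * Q b * (n 0 * rightJp σ p₃ P (eta σ 0) a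
          + σ.sgn * n 1 * rightJp σ p₃ P (eta σ 1) a
          + σ.sgn * n 2 * rightJp σ p₃ P (eta σ 2) a) := by
    have hs := σ.sgn_mul_self
    generalize eta σ b = y
    fin_cases a <;> simp [rightJp, cross, eta, Matrix.diagonal] <;> grind
  have h2 : ∀ c, dot σ (adj σ p₃ P (Pi.single c 1)) n = adj σ p₃ P (Pi.single c 1) 0 * n 0
      + σ.sgn * adj σ p₃ P (Pi.single c 1) 1 * n 1
      + σ.sgn * adj σ p₃ P (Pi.single c 1) 2 * n 2 := fun c ↦ dot_eq _ _
  have h := sum_adj_mul_leftJp p₃ P hP a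
  rw [h1]
  simp only [h2]
  have h0 := h 0
  have h1 := h 1
  have h2 := h 2
  have hb := h b
  simp only [Fin.sum_univ_three] at h0 h1 h2 hb ⊢
  linear_combination (-(q₃ - dot σ Q n / 2)) * hb - 1 / 2 * Q b * n 0 * h0
    - 1 / 2 * Q b * σ.sgn * n 1 * h1 - 1 / 2 * Q b * σ.sgn * n 2 * h2

theorem rightS_mul_leftJ {p₃ q₃ : ℝ} {P Q n : Fin 3 → ℝ} (a b : Fin 3) :
    -rightJp σ p₃ P (fun d ↦ (q₃ - dot σ Q n / 2) * eta σ b d + 1 / 2 * Q b * n d) a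
      - ∑ c, ((q₃ + dot σ Q n / 2) * (Pi.single c 1 : Fin 3 → ℝ) b
        - dot σ (Pi.single c 1) n / 2 * Q b) * leftJp σ p₃ P (eta σ c) a
      = q₃ * (∑ c, eps a b c * lower σ P c) + p₃ * (dot σ Q n * eta σ a b - n a * Q b) := by
  generalize dot σ Q n = k
  cases σ <;> fin_cases a <;> fin_cases b <;>
    simp [Fin.sum_univ_three, leftJp, rightJp, cross, eta, Matrix.diagonal, Signature.sgn, dot_eq,
      eps, lower] <;> ring

theorem rightS_mul_rightJ_q {q₃ : ℝ} {Q n : Fin 3 → ℝ} (hQ : q₃ ^ 2 = 1 + dot σ Q n ^ 2 / 4)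
    (a b : Fin 3) :
    ∑ c, ((q₃ + dot σ Q n / 2) * (Pi.single c 1 : Fin 3 → ℝ) a
        - dot σ (Pi.single c 1) n / 2 * Q a) *
          (1 / 2 * cross σ Q (eta σ c) b
            - 1 / 2 * cross σ (dress σ (q₃ - dot σ Q n / 2) Q n (eta σ c)) Q b)
      = q₃ * ∑ c, eps a b c * lower σ Q c := by
  have h : ∀ w x y : ℝ, w * (1 / 2 * x - 1 / 2 * y) = w * x / 2 - w * y / 2 := by intros; ring
  simp only [h, Finset.sum_sub_distrib, ← Finset.sum_div]
  rw [sum_mul_cross]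
  simp_rw [sum_mul_dress hQ]
  generalize dot σ Q n = k
  cases σ <;> fin_cases a <;> fin_cases b <;>
    simp [Fin.sum_univ_three, cross, eta, Matrix.diagonal, Signature.sgn, dot_eq,
      eps, lower] <;> ring

theorem rightS_wedge_rightJ {q₃ : ℝ} {Q n : Fin 3 → ℝ} (hQ : q₃ ^ 2 = 1 + dot σ Q n ^ 2 / 4)
    (a b : Fin 3) :
    ∑ c, (((q₃ + dot σ Q n / 2) * (Pi.single c 1 : Fin 3 → ℝ) a
        - dot σ (Pi.single c 1) n / 2 * Q a) *
          (1 / 2 * cross σ Q (eta σ c) b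
            - 1 / 2 * cross σ (dress σ (q₃ - dot σ Q n / 2) Q n (eta σ c)) Q b)
      - ((q₃ + dot σ Q n / 2) * (Pi.single c 1 : Fin 3 → ℝ) b
        - dot σ (Pi.single c 1) n / 2 * Q b) *
          (1 / 2 * cross σ Q (eta σ c) a
            - 1 / 2 * cross σ (dress σ (q₃ - dot σ Q n / 2) Q n (eta σ c)) Q a))
      = 2 * (q₃ * ∑ c, eps a b c * lower σ Q c) := by
  rw [Finset.sum_sub_distrib, rightS_mul_rightJ_q hQ, rightS_mul_rightJ_q hQ]
  simp only [eps, Fin.sum_univ_three]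
  ring

/-! ### The Poisson brackets of the coordinates -/

section Brackets

variable {n : Fin 3 → ℝ} {g : H σ Λ}

theorem bracketS_p_p (hn : dot σ n n = -Λ) (hg : g ∈ F σ Λ n) (a b : Fin 3) :
    bracketS n (p n a) (p n b) g = -p3 n g * (n a * p n b g - p n a g * n b) := by
  have h := leftS_wedge_leftJ (p3 n g) (fun i ↦ p n i g) n (p3_sq hn hg) a b
  simp only [bracketS, sklyaninBracket, wedge, vecR_S_p hn hg, vecL_J_p hn hg, vecL_S_p hn hg,
    zero_mul, sub_zero, zero_sub, Finset.sum_neg_distrib]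
  rw [h]
  ring

theorem bracketD_p_p (hn : dot σ n n = -Λ) (hg : g ∈ F σ Λ n) (a b : Fin 3) :
    bracketD n (p n a) (p n b) g = p3 n g * (n a * p n b g - p n a g * n b) := by
  have h := leftS_wedge_leftJ (p3 n g) (fun i ↦ p n i g) n (p3_sq hn hg) a b
  simp only [bracketD, dualBracket, wedge, vecR_S_p hn hg, vecL_J_p hn hg, vecL_S_p hn hg,
    zero_mul, sub_zero, zero_add, Finset.sum_const_zero, add_zero]
  rw [h]
  ring

theorem bracketS_q_q (hn : dot σ n n = -Λ) (hg : g ∈ F σ Λ n) (a b : Fin 3) :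
    bracketS n (q n a) (q n b) g = q3 n g * ∑ c, eps a b c * lower σ (fun d ↦ q n d g) c := by
  have h := rightS_wedge_rightJ (Q := fun i ↦ q n i g) (q3_sq n g) a b
  simp only [bracketS, sklyaninBracket, wedge, vecR_S_q hn hg, vecL_J_q hn hg, vecR_J_q hn hg,
    mul_zero, sub_zero]
  rw [← qn] at h
  rw [h]
  ring

theorem bracketD_q_q (hn : dot σ n n = -Λ) (hg : g ∈ F σ Λ n) (a b : Fin 3) :
    bracketD n (q n a) (q n b) g = q3 n g * ∑ c, eps a b c * lower σ (fun d ↦ q n d g) c := by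
  have h := rightS_wedge_rightJ (Q := fun i ↦ q n i g) (q3_sq n g) a b
  simp only [bracketD, dualBracket, wedge, vecR_S_q hn hg, vecL_J_q hn hg, vecR_J_q hn hg,
    mul_zero, sub_zero, add_zero, Finset.sum_const_zero]
  rw [← qn] at h
  rw [h]
  ring

theorem bracketS_p_q (hn : dot σ n n = -Λ) (hg : g ∈ F σ Λ n) (a b : Fin 3) :
    bracketS n (p n a) (q n b) g = 0 := by
  have h1 := rightS_mul_rightJ_p (p₃ := p3 n g) (P := fun i ↦ p n i g) (Q := fun i ↦ q n i g)
    (q3_sq n g) a b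
  have h2 := leftS_mul_leftJ (q₃ := q3 n g) (Q := fun i ↦ q n i g) (n := n) (p3_sq hn hg) a b
  rw [← qn] at h1 h2
  simp only [bracketS, sklyaninBracket, wedge, vecR_S_q hn hg, vecR_S_p hn hg, vecR_J_p hn hg,
    vecL_J_q hn hg, vecL_J_p hn hg, vecL_S_q hn hg, mul_zero, zero_mul, zero_sub, sub_neg_eq_add,
    Finset.sum_add_distrib, Finset.sum_neg_distrib]
  rw [h1, h2]
  ring

theorem bracketD_p_q (hn : dot σ n n = -Λ) (hg : g ∈ F σ Λ n) (a b : Fin 3) :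
    bracketD n (p n a) (q n b) g = q3 n g * (∑ c, eps a b c * lower σ (fun d ↦ p n d g) c)
      + p3 n g * (qn n g * eta σ a b - n a * q n b g) := by
  have h1 := rightS_mul_rightJ_p (p₃ := p3 n g) (P := fun i ↦ p n i g) (Q := fun i ↦ q n i g)
    (q3_sq n g) a b
  have h2 := leftS_mul_leftJ (q₃ := q3 n g) (Q := fun i ↦ q n i g) (n := n) (p3_sq hn hg) a b
  have h3 := rightS_mul_leftJ (σ := σ) (p₃ := p3 n g) (q₃ := q3 n g) (P := fun i ↦ p n i g)
    (Q := fun i ↦ q n i g) (n := n) a b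
  rw [← qn] at h1 h2 h3
  simp only [bracketD, dualBracket, wedge, vecR_S_q hn hg, vecR_S_p hn hg, vecR_J_p hn hg,
    vecL_J_q hn hg, vecL_J_p hn hg, vecL_S_q hn hg, mul_zero, zero_mul, zero_sub,
    Finset.sum_add_distrib, Finset.sum_neg_distrib]
  rw [h1, h2, ← h3]
  ring

/-! ### The Casimir functions -/

theorem im_proj_eq (hn : dot σ n n = -Λ) (hg : g ∈ F σ Λ n) :
    (proj (u n g * s n g)).im
      = -(1 / 4) * ∑ a, lower σ (fun d ↦ p n d g) a * q n a g := by
  have hs := σ.sgn_mul_self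
  rw [u_eq hn hg, s_eq hn hg, funext (p_eq hn hg), Finset.sum_congr rfl fun a _ ↦ by
    rw [q_eq hn hg]]
  nth_rw 1 [eq_smul_one_add_vec (conjTheta_uFun n g), sFun_eq_anElt hn hg]
  generalize qOf (sFun n g) = Q
  generalize pOf (uFun n g) = P
  simp [Fin.sum_univ_three, lower, eta, Matrix.diagonal, proj, anElt, sVec_eq, vec_eq]
  grind

theorem re_proj_eq (hn : dot σ n n = -Λ) (hg : g ∈ F σ Λ n) :
    (proj (u n g * s n g)).re = p3 n g * q3 n g
      - 1 / 4 * ∑ a, ∑ b, ∑ c, eps a b c * n a * p n b g * q n c g := by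
  have hs := σ.sgn_mul_self
  rw [p3_eq hn hg, q3_eq hn hg]
  simp only [p_eq hn hg, q_eq hn hg]
  rw [u_eq hn hg, s_eq hn hg]
  nth_rw 1 [eq_smul_one_add_vec (conjTheta_uFun n g), sFun_eq_anElt hn hg]
  rw [anElt]
  generalize √(1 + dot σ (qOf (sFun n g)) n ^ 2 / 4) = r
  generalize qOf (sFun n g) = Q
  generalize pOf (uFun n g) = P
  simp [Fin.sum_univ_three, eps, proj, sVec_eq, vec_eq]
  grind

end Brackets

section Casimir

variable {n : Fin 3 → ℝ} {g : H σ Λ}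

/-- `F(n)` is not open in `ℍ(R_Λ)`, so the within-derivative need not be unique; any choice
satisfies the chain rule along curves that stay in `F(n)`. -/
theorem SmoothOnF.deriv_comp (hn : dot σ n n = -Λ) (hg : g ∈ F σ Λ n) {f : H σ Λ → ℝ}
    (hf : SmoothOnF n f) {γ : ℝ → H σ Λ} {v : H σ Λ} (hγ : HasDerivAt γ v 0)
    (hγ0 : γ 0 = g) (hγu : ∀ r, γ r ∈ unitGroup σ Λ) :
    deriv (fun r ↦ f (γ r)) 0 = fderivWithin ℝ f (F σ Λ n) g v := by
  have hd : DifferentiableWithinAt ℝ f (F σ Λ n) (γ 0) :=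
    hγ0 ▸ hf.differentiableOn (by simp) g hg
  have h := (hd.hasFDerivWithinAt.comp_hasDerivAt (0 : ℝ) hγ
    (eventually_mem_F hn hg hγ.continuousAt hγ0 hγu)).deriv
  rwa [hγ0] at h

theorem SmoothOnF.vecR_eq (hn : dot σ n n = -Λ) (hg : g ∈ F σ Λ n) {f : H σ Λ → ℝ}
    (hf : SmoothOnF n f) {X : H σ Λ} (hX : star X = -X) :
    vecR X f g = fderivWithin ℝ f (F σ Λ n) g (g * X) :=
  hf.deriv_comp hn hg (hasDerivAt_mul_exp g X) (by simp) (mul_exp_mem_unitGroup hX hg.1)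

theorem SmoothOnF.vecL_eq (hn : dot σ n n = -Λ) (hg : g ∈ F σ Λ n) {f : H σ Λ → ℝ}
    (hf : SmoothOnF n f) {X : H σ Λ} (hX : star X = -X) :
    vecL X f g = -fderivWithin ℝ f (F σ Λ n) g (X * g) := by
  rw [← map_neg, ← neg_mul]
  exact hf.deriv_comp hn hg (hasDerivAt_exp_neg_mul g X) (by simp)
    (exp_neg_mul_mem_unitGroup hX hg.1)

theorem vecR_of_eqOn (hn : dot σ n n = -Λ) (hg : g ∈ F σ Λ n) {C : H σ Λ → ℝ} {l : H σ Λ →L[ℝ] ℝ}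
    (hC : Set.EqOn C l (F σ Λ n)) {X : H σ Λ} (hX : star X = -X) : vecR X C g = l (g * X) := by
  have hγ := hasDerivAt_mul_exp g X
  have hev := eventually_mem_F hn hg hγ.continuousAt (by simp) (mul_exp_mem_unitGroup hX hg.1)
  exact ((l.hasFDerivAt.comp_hasDerivAt (0 : ℝ) hγ).congr_of_eventuallyEq
    (hev.mono fun r hr ↦ hC hr)).deriv

theorem vecL_of_eqOn (hn : dot σ n n = -Λ) (hg : g ∈ F σ Λ n) {C : H σ Λ → ℝ} {l : H σ Λ →L[ℝ] ℝ}
    (hC : Set.EqOn C l (F σ Λ n)) {X : H σ Λ} (hX : star X = -X) : vecL X C g = -l (X * g) := by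
  have hγ := hasDerivAt_exp_neg_mul g X
  have hev := eventually_mem_F hn hg hγ.continuousAt (by simp) (exp_neg_mul_mem_unitGroup hX hg.1)
  rw [← map_neg, ← neg_mul]
  exact ((l.hasFDerivAt.comp_hasDerivAt (0 : ℝ) hγ).congr_of_eventuallyEq
    (hev.mono fun r hr ↦ hC hr)).deriv

theorem star_S (n : Fin 3 → ℝ) (a : Fin 3) : star (S n a : H σ Λ) = -S n a := by
  rw [S_eq, star_sVec]

theorem star_JUp (a : Fin 3) : star (JUp a : H σ Λ) = -JUp a := by
  rw [JUp_eq, star_jVec]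

/-- A class function that is the restriction of a linear functional is a Casimir function of the
dual bracket as soon as its differential, transported by the `r`-matrix, commutes with `g`. -/
theorem isCasimirD_of_eqOn (hn : dot σ n n = -Λ) {C : H σ Λ → ℝ} {l : H σ Λ →L[ℝ] ℝ}
    (hC : Set.EqOn C l (F σ Λ n)) (hl : ∀ x y, l (x * y) = l (y * x))
    (hcomm : ∀ g : H σ Λ, Commute g (∑ c, (l (g * S n c) • JUp c + l (g * JUp c) • S n c))) :
    IsCasimirD n C := by
  refine ⟨l.contDiff.contDiffOn.congr hC, fun f hf g hg ↦ ?_⟩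
  set D := fderivWithin ℝ f (F σ Λ n) g
  have hR1 : ∀ c, vecR (S n c) f g = D (g * S n c) := fun c ↦ hf.vecR_eq hn hg (star_S n c)
  have hR2 : ∀ c, vecR (JUp c) f g = D (g * JUp c) := fun c ↦ hf.vecR_eq hn hg (star_JUp c)
  have hL1 : ∀ c, vecL (S n c) f g = -D (S n c * g) := fun c ↦ hf.vecL_eq hn hg (star_S n c)
  have hL2 : ∀ c, vecL (JUp c) f g = -D (JUp c * g) := fun c ↦ hf.vecL_eq hn hg (star_JUp c)
  -- Cyclicity of `l` makes the left derivatives of `C` the negatives of the right ones. The bracket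
  -- then becomes half of `D` on the commutator of `g` with the sum in `hcomm`.
  have hK := congrArg D (hcomm g).eq
  simp only [Finset.mul_sum, Finset.sum_mul, mul_add, add_mul, mul_smul_comm, smul_mul_assoc,
    map_sum, map_add, map_smul, smul_eq_mul] at hK
  rw [← sub_eq_zero, ← Finset.sum_sub_distrib] at hK
  simp only [bracketD, dualBracket, wedge, hR1, hR2, hL1, hL2, vecR_of_eqOn hn hg hC (star_S n _),
    vecR_of_eqOn hn hg hC (star_JUp _), vecL_of_eqOn hn hg hC (star_S n _),
    vecL_of_eqOn hn hg hC (star_JUp _), hl (S n _) g, hl (JUp _) g]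
  rw [Finset.mul_sum, ← Finset.sum_add_distrib]
  refine Eq.trans ?_ ((congrArg (1 / 2 * ·) hK).trans (mul_zero _))
  rw [Finset.mul_sum]
  exact Finset.sum_congr rfl fun c _ ↦ by ring

theorem commute_sub_star (g : H σ Λ) : Commute g (g - star g) :=
  (Commute.refl g).sub_right (star_comm_self' g).symm

/-- The `n`-terms of `S_c` cancel between the two summands by antisymmetry of `ε`. The rest expands
the pure part `(g - ḡ) / 2` in the basis `e_c`, `θ e_c`, whose two halves are paired by `Im_θ Π`. -/
theorem sum_imCLM (n : Fin 3 → ℝ) (g : H σ Λ) :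
    ∑ c, (imCLM (g * S n c) • JUp c + imCLM (g * JUp c) • S n c)
      = (-(1 / 8) : ℝ) • (g - star g) := by
  have hs := σ.sgn_mul_self
  simp only [S_eq, JUp_eq, sVec_eq, jVec, vec_eq]
  ext <;> simp [Fin.sum_univ_three, eta, Matrix.diagonal] <;> grind

/-- Since `Re_θ z = Im_θ (θ z)`, this is the contraction `sum_imCLM` evaluated at `θ g`. -/
theorem sum_reCLM (n : Fin 3 → ℝ) (g : H σ Λ) :
    ∑ c, (reCLM (g * S n c) • JUp c + reCLM (g * JUp c) • S n c)
      = theta Λ • ((-(1 / 8) : ℝ) • (g - star g)) := by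
  have hs := σ.sgn_mul_self
  simp only [S_eq, JUp_eq, sVec_eq, jVec, vec_eq]
  ext <;> simp [Fin.sum_univ_three, eta, Matrix.diagonal, theta] <;> grind

theorem isCasimirD_im (hn : dot σ n n = -Λ) :
    IsCasimirD (σ := σ) (Λ := Λ) n (fun g ↦ (proj (u n g * s n g)).im) := by
  refine isCasimirD_of_eqOn (l := imCLM) hn (fun g hg ↦ by simp only [u_mul_s hn hg]; rfl)
    (fun x y ↦ congrArg QuadraticAlgebra.im (re_mul_comm x y)) fun g ↦ ?_
  rw [sum_imCLM]
  exact (commute_sub_star g).smul_right _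

theorem isCasimirD_re (hn : dot σ n n = -Λ) :
    IsCasimirD (σ := σ) (Λ := Λ) n (fun g ↦ (proj (u n g * s n g)).re) := by
  refine isCasimirD_of_eqOn (l := reCLM) hn (fun g hg ↦ by simp only [u_mul_s hn hg]; rfl)
    (fun x y ↦ congrArg QuadraticAlgebra.re (re_mul_comm x y)) fun g ↦ ?_
  rw [sum_reCLM]
  exact ((commute_sub_star g).smul_right _).smul_right _

end Casimir

end Gravity3d

end

theorem mainTheorem3 (σ : Gravity3d.Signature) (Λ : ℝ) (n : Fin 3 → ℝ)
    (hn : Gravity3d.dot σ n n = -Λ) :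
    -- on `F(n)` the factorisation exists and is unique, and the coordinates are smooth
    (∀ g ∈ Gravity3d.F σ Λ n, ∃! us, Gravity3d.IsFactorisation n g us) ∧
    (∀ a, Gravity3d.SmoothOnF (σ := σ) (Λ := Λ) n (Gravity3d.p n a) ∧
      Gravity3d.SmoothOnF (σ := σ) (Λ := Λ) n (Gravity3d.q n a)) ∧
    Gravity3d.SmoothOnF (σ := σ) (Λ := Λ) n (Gravity3d.p3 n) ∧
    Gravity3d.SmoothOnF (σ := σ) (Λ := Λ) n (Gravity3d.q3 n) ∧
    (∀ g ∈ Gravity3d.F σ Λ n,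
      Gravity3d.p3 n g
          = √(1 - Gravity3d.dot σ (fun a ↦ Gravity3d.p n a g) (fun a ↦ Gravity3d.p n a g) / 4) ∨
      Gravity3d.p3 n g
          = -√(1 - Gravity3d.dot σ (fun a ↦ Gravity3d.p n a g) (fun a ↦ Gravity3d.p n a g) / 4)) ∧
    -- the Sklyanin bracket
    (∀ g ∈ Gravity3d.F σ Λ n, ∀ a b : Fin 3,
      Gravity3d.bracketS n (Gravity3d.p n a) (Gravity3d.p n b) g
        = -Gravity3d.p3 n g * (n a * Gravity3d.p n b g - Gravity3d.p n a g * n b) ∧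
      Gravity3d.bracketS n (Gravity3d.q n a) (Gravity3d.q n b) g
        = Gravity3d.q3 n g *
            ∑ c, Gravity3d.eps a b c * Gravity3d.lower σ (fun d ↦ Gravity3d.q n d g) c ∧
      Gravity3d.bracketS n (Gravity3d.p n a) (Gravity3d.q n b) g = 0) ∧
    -- the dual bracket
    (∀ g ∈ Gravity3d.F σ Λ n, ∀ a b : Fin 3,
      Gravity3d.bracketD n (Gravity3d.p n a) (Gravity3d.p n b) g
        = Gravity3d.p3 n g * (n a * Gravity3d.p n b g - Gravity3d.p n a g * n b) ∧
      Gravity3d.bracketD n (Gravity3d.q n a) (Gravity3d.q n b) g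
        = Gravity3d.q3 n g *
            ∑ c, Gravity3d.eps a b c * Gravity3d.lower σ (fun d ↦ Gravity3d.q n d g) c ∧
      Gravity3d.bracketD n (Gravity3d.p n a) (Gravity3d.q n b) g
        = Gravity3d.q3 n g *
            (∑ c, Gravity3d.eps a b c * Gravity3d.lower σ (fun d ↦ Gravity3d.p n d g) c)
          + Gravity3d.p3 n g *
            (Gravity3d.qn n g * Gravity3d.eta σ a b - n a * Gravity3d.q n b g)) ∧
    -- the two functions `Im_θ Π (u s)` and `Re_θ Π (u s)`
    (∀ g ∈ Gravity3d.F σ Λ n,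
      (Gravity3d.proj (Gravity3d.u n g * Gravity3d.s n g)).im
        = -(1 / 4) * ∑ a, Gravity3d.lower σ (fun d ↦ Gravity3d.p n d g) a * Gravity3d.q n a g ∧
      (Gravity3d.proj (Gravity3d.u n g * Gravity3d.s n g)).re
        = Gravity3d.p3 n g * Gravity3d.q3 n g
          - 1 / 4 * ∑ a, ∑ b, ∑ c,
              Gravity3d.eps a b c * n a * Gravity3d.p n b g * Gravity3d.q n c g) ∧
    Gravity3d.IsCasimirD (σ := σ) (Λ := Λ) n
      (fun g ↦ (Gravity3d.proj (Gravity3d.u n g * Gravity3d.s n g)).im) ∧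
    Gravity3d.IsCasimirD (σ := σ) (Λ := Λ) n
      (fun g ↦ (Gravity3d.proj (Gravity3d.u n g * Gravity3d.s n g)).re) :=
  ⟨fun _ hg ↦ Gravity3d.existsUnique_isFactorisation hn hg,
    fun a ↦ ⟨Gravity3d.smoothOnF_p hn a, Gravity3d.smoothOnF_q hn a⟩,
    Gravity3d.smoothOnF_p3 hn, Gravity3d.smoothOnF_q3 hn,
    fun _ hg ↦ Gravity3d.p3_eq_or hn hg,
    fun _ hg a b ↦ ⟨Gravity3d.bracketS_p_p hn hg a b, Gravity3d.bracketS_q_q hn hg a b,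
      Gravity3d.bracketS_p_q hn hg a b⟩,
    fun _ hg a b ↦ ⟨Gravity3d.bracketD_p_p hn hg a b, Gravity3d.bracketD_q_q hn hg a b,
      Gravity3d.bracketD_p_q hn hg a b⟩,
    fun _ hg ↦ ⟨Gravity3d.im_proj_eq hn hg, Gravity3d.re_proj_eq hn hg⟩,
    Gravity3d.isCasimirD_im hn, Gravity3d.isCasimirD_re hn⟩
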